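/- For integers $d\ge 1$ and $n\ge 0$, let $a_d(n)$ denote the number of partitions of $n$ in which the odd parts are unrestricted and each even part may independently be given one of $d$ colors (the order of the parts is irrelevant, and $a_d(0)=1$). **Theorem.** For all integers $n\ge 0$, \[ a_5(49n+31)\equiv 0 \pmod 7 \qquad\text{and}\qquad a_9(121n+36)\equiv 0 \pmod{11}. \] -/

import Mathlib

/-- The number of colors available for a part of size `m`: even parts may be given any one of `d`
colors, while odd parts come in a single color. -/
def partColors (d m : ℕ) : ℕ := if Even m then d else 1

/-- A generalized cubic partition of `n` with parameter `d`: a partition of `n` in which the odd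
parts are unrestricted and each even part carries one of `d` colors, the colors being chosen
independently. It is a finite multiset of colored parts `(m, c)`, where `m` is the size of the part
and `c` is its color; the sizes are positive and sum to `n`. -/
@[ext]
structure CubicPartition (d n : ℕ) where
  /-- the colored parts `(size, color)`, with multiplicity and without order -/
  parts : Multiset (ℕ × ℕ)
  /-- the parts are positive -/
  size_pos : ∀ x ∈ parts, 0 < x.1
  /-- the color of a part is one of the colors available for its size -/
  color_lt : ∀ x ∈ parts, x.2 < partColors d x.1
  /-- the sizes of the parts sum to `n` -/
  size_sum : (parts.map Prod.fst).sum = n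

/-- There are only finitely many generalized cubic partitions of `n`. -/
instance CubicPartition.instFinite (d n : ℕ) : Finite (CubicPartition d n) := by
  classical
  let T : Multiset (ℕ × ℕ) := (Finset.range (n + 1) ×ˢ Finset.range (d + 1)).val
  have hle : ∀ p : CubicPartition d n, p.parts ≤ n • T := by
    intro p
    rw [Multiset.le_iff_count]
    intro x
    by_cases hx : x ∈ p.parts
    · have hcard : Multiset.card p.parts ≤ n := by
        have h := Multiset.card_nsmul_le_sum (s := p.parts.map Prod.fst) (a := 1) (by
          intro m hm
          obtain ⟨y, hy, rfl⟩ := Multiset.mem_map.mp hm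
          exact p.size_pos y hy)
        simpa [p.size_sum] using h
      have hsize : x.1 ≤ n := by
        have h := Multiset.le_sum_of_mem (Multiset.mem_map_of_mem Prod.fst hx)
        rwa [p.size_sum] at h
      have hcol : x.2 < d + 1 := by
        have h := p.color_lt x hx
        unfold partColors at h
        split_ifs at h <;> omega
      have hmem : x ∈ T := by
        change x ∈ Finset.range (n + 1) ×ˢ Finset.range (d + 1)
        simp only [Finset.mem_product, Finset.mem_range]
        omega
      have h1 : 1 ≤ T.count x := Multiset.one_le_count_iff_mem.mpr hmem
      rw [Multiset.count_nsmul]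
      have h2 := Multiset.count_le_card x p.parts
      nlinarith
    · rw [Multiset.count_eq_zero_of_notMem hx]
      exact Nat.zero_le _
  exact Finite.of_injective
    (fun p : CubicPartition d n => (⟨p.parts, hle p⟩ : Set.Iic (n • T)))
    (fun p q h => CubicPartition.ext (congrArg Subtype.val h))

/-- `cubicPartitionCount d n` is the number `a_d(n)` of generalized cubic partitions of `n`. -/
noncomputable def cubicPartitionCount (d n : ℕ) : ℕ := Nat.card (CubicPartition d n)

open PowerSeries Finset

/-! Write E = ∏ (1 - q^i) (`pentagonalSeries`), F = E(q²), and let p = d + 2 be 7 or 11. The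
generating function is G = 1/(E F^(d-1)), so F^p G = F³/E =: θ. Modulo p, F^p = F(q^p), so
extracting the exponents 3 mod p gives F·D = U(θ), where D = ∑ a_d(pn+3) q^n and U(θ) is the same
extraction of θ.

By Gauss, θ = F ∑ q^(k(k+1)/2), so twice its N-th coefficient is a signed count of solutions of 2x²
+ 3y² = 24N + 5. As 24·3 + 5 = 7·11, the exponents N ≡ 3 mod p are those with p ∣ 24N + 5. For them,
reflections of the form built from a + t√-6 of norm p² cancel everything except what the solutions
with p ∣ x and p ∣ y account for, and rescaling these gives U(θ) = ±q^s θ(q^p), with s = 1 or 2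
(`sum_sign12_seven`, `sum_sign12_eleven`).

Multiplying by E^p and using Eθ = F³ yields E(q^p) D = ±F(q^p)² · q^s F^(p-1). A second extraction
(`cubicPartitionCount_modEq_zero`) leaves the vanishing mod p of the coefficients of E^(p-1) at
exponents 5 mod 7, respectively 6 mod 11. For 7, Jacobi's formula for E³ suffices. For 11, E^12 =
E·E(q^11) lives on pentagonal residues, which gives five quartic relations between the residue-class
components of E³; the class-6 component of E^21 = E^10 E^11 is a combination of them. -/

/-- The finite Euler product `∏_{i=1}^{n} (1 - q^i)`. -/
noncomputable def eulerProd (R : Type*) [CommRing R] (n : ℕ) : R⟦X⟧ :=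
  ∏ i ∈ range n, (1 - X ^ (i + 1))

/-! ### Truncation of power series modulo powers of q -/

section Congruence

variable {R : Type*} [CommRing R]

/-- Reduction of power series modulo `X ^ n`. -/
noncomputable def modXPow (n : ℕ) : R⟦X⟧ →+* R⟦X⟧ ⧸ Ideal.span {(X : R⟦X⟧) ^ n} :=
  Ideal.Quotient.mk _

theorem modXPow_eq_iff_dvd {n : ℕ} {f g : R⟦X⟧} : modXPow n f = modXPow n g ↔ X ^ n ∣ f - g := by
  rw [modXPow, Ideal.Quotient.eq, Ideal.mem_span_singleton]

theorem modXPow_eq_iff {n : ℕ} {f g : R⟦X⟧} :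
    modXPow n f = modXPow n g ↔ ∀ m < n, coeff m f = coeff m g := by
  rw [modXPow_eq_iff_dvd, X_pow_dvd_iff]
  simp [sub_eq_zero]

theorem eq_of_forall_modXPow {f g : R⟦X⟧} (h : ∀ n, modXPow (n + 1) f = modXPow (n + 1) g) :
    f = g := by
  ext n
  exact modXPow_eq_iff.mp (h n) n (Nat.lt_succ_self n)

theorem modXPow_X_pow {m n : ℕ} (hmn : n ≤ m) : modXPow n ((X : R⟦X⟧) ^ m) = 0 := by
  rw [← map_zero (modXPow n), modXPow_eq_iff_dvd, sub_zero]
  exact pow_dvd_pow _ hmn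

theorem modXPow_expand {p n : ℕ} (hp : p ≠ 0) {f g : R⟦X⟧} (h : modXPow n f = modXPow n g) :
    modXPow n (expand p hp f) = modXPow n (expand p hp g) := by
  rw [modXPow_eq_iff] at h ⊢
  intro m hm
  rw [coeff_expand, coeff_expand]
  split_ifs with hd
  · exact h _ ((Nat.div_le_self m p).trans_lt hm)
  · rfl

end Congruence

/-! ### Finite Euler products as truncations of the infinite one -/

section Euler

variable (R : Type*) [CommRing R]

theorem eulerProd_zero : eulerProd R 0 = 1 := by simp [eulerProd]

theorem eulerProd_succ (n : ℕ) : eulerProd R (n + 1) = eulerProd R n * (1 - X ^ (n + 1)) := by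
  simp [eulerProd, prod_range_succ]

theorem modXPow_eulerProd_of_le {n m : ℕ} (h : n ≤ m) :
    modXPow (n + 1) (eulerProd R m) = modXPow (n + 1) (eulerProd R n) := by
  induction m, h using Nat.le_induction with
  | base => rfl
  | succ m hm ih =>
    rw [eulerProd_succ, map_mul, map_sub, modXPow_X_pow (by omega), ih]
    simp

theorem modXPow_pentagonalSeries {n m : ℕ} (h : n ≤ m) :
    modXPow (n + 1) (pentagonalSeries R) = modXPow (n + 1) (eulerProd R m) := by
  rw [modXPow_eulerProd_of_le R h, modXPow_eq_iff]
  intro k hk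
  have h1 := Filter.tendsto_finset_range.eventually (coeff_prod_one_sub_X_pow_eventually_eq R k)
  obtain ⟨M, h2, h3⟩ := (h1.and (Filter.eventually_ge_atTop n)).exists
  rw [← h2]
  exact modXPow_eq_iff.mp (modXPow_eulerProd_of_le R h3) k hk

theorem constantCoeff_eulerProd (n : ℕ) : constantCoeff (eulerProd R n) = 1 := by
  simp [eulerProd, map_prod]

theorem isUnit_eulerProd (n : ℕ) : IsUnit (eulerProd R n) := by
  rw [isUnit_iff_constantCoeff, constantCoeff_eulerProd]
  exact isUnit_one

theorem constantCoeff_pentagonalSeries : constantCoeff (pentagonalSeries R) = 1 := by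
  have h := modXPow_eq_iff.mp (modXPow_pentagonalSeries R (le_refl 0)) 0 Nat.one_pos
  simpa [eulerProd_zero] using h

theorem isUnit_pentagonalSeries : IsUnit (pentagonalSeries R) := by
  rw [isUnit_iff_constantCoeff, constantCoeff_pentagonalSeries]
  exact isUnit_one

end Euler

/-! ### Triangular numbers -/

theorem triangle_succ (k : ℕ) : (k + 1) * (k + 2) / 2 = k * (k + 1) / 2 + (k + 1) := by
  rw [show (k + 1) * (k + 2) = k * (k + 1) + (k + 1) * 2 by ring,
    Nat.add_mul_div_right _ _ two_pos]

theorem le_triangle (k : ℕ) : k ≤ k * (k + 1) / 2 := by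
  rcases k with _ | k
  · simp
  · rw [Nat.le_div_iff_mul_le two_pos]
    gcongr
    omega

theorem triangle_injective {k l : ℕ} (h : k * (k + 1) / 2 = l * (l + 1) / 2) : k = l := by
  have hm : StrictMono fun k : ℕ => k * (k + 1) / 2 :=
    strictMono_nat_of_lt_succ fun k => by
      have := triangle_succ k
      simp only [add_assoc, one_add_one_eq_two]
      omega
  exact hm.injective h

/-! ### A finite Jacobi triple product -/

section TripleProduct

variable (R : Type*) [CommRing R]

/-- The coefficient of `z ^ k` (equivalently of `z ^ (-k-1)`) in the finite triple product
`(1 + z⁻¹) * ∏_{i=1}^{n} (1 + z q^i) (1 + z⁻¹ q^i)`. -/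
noncomputable def tripleCoeff : ℕ → ℕ → R⟦X⟧
  | 0, 0 => 1
  | 0, _ + 1 => 0
  -- The neighbour of z^0 on the left is z^(-1), whose coefficient equals that of z^0 by the
  -- symmetry k ↔ -k-1.
  | n + 1, 0 => X ^ (n + 1) * tripleCoeff n 0 + (1 + X ^ (2 * n + 2)) * tripleCoeff n 0 +
      X ^ (n + 1) * tripleCoeff n 1
  | n + 1, k + 1 => X ^ (n + 1) * tripleCoeff n k + (1 + X ^ (2 * n + 2)) * tripleCoeff n (k + 1) +
      X ^ (n + 1) * tripleCoeff n (k + 2)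

theorem tripleCoeff_of_lt (n : ℕ) : ∀ k, n < k → tripleCoeff R n k = 0 := by
  induction n with
  | zero =>
    intro k hk
    obtain ⟨k, rfl⟩ := Nat.exists_eq_succ_of_ne_zero hk.ne'
    rw [tripleCoeff]
  | succ n ih =>
    intro k hk
    obtain ⟨k, rfl⟩ := Nat.exists_eq_succ_of_ne_zero (Nat.zero_lt_of_lt hk).ne'
    rw [tripleCoeff, ih k (by omega), ih (k + 1) (by omega), ih (k + 2) (by omega)]
    simp

/-- A form of the q-binomial theorem with denominators cleared: for n = k + j the coefficient is
q^(k(k+1)/2) (q)_{2n+1} / ((q)_{n-k} (q)_{n+k+1}). The induction checks that this satisfies the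
defining recurrence. -/
theorem tripleCoeff_mul_eulerProd (n : ℕ) : ∀ k j, k + j = n →
    tripleCoeff R n k * eulerProd R j * eulerProd R (2 * k + j + 1) =
      X ^ (k * (k + 1) / 2) * eulerProd R (2 * k + 2 * j + 1) := by
  induction n with
  | zero =>
    intro k j h
    obtain ⟨rfl, rfl⟩ : k = 0 ∧ j = 0 := by omega
    simp [tripleCoeff, eulerProd_zero]
  | succ n ih =>
    intro k j h
    rcases k with _ | k
    · obtain rfl : j = n + 1 := by omega
      rcases n with _ | n
      · simp [tripleCoeff, eulerProd_succ, eulerProd_zero]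
        ring
      · have h0 := ih 0 (n + 1) (by omega)
        have h1 := ih 1 n (by omega)
        simp only [tripleCoeff, eulerProd_succ, mul_zero, zero_add, mul_one, Nat.zero_div,
          pow_zero, one_mul, show 2 * (n + 1) = 2 * n + 2 from rfl,
          show 2 * (n + 1 + 1) = 2 * n + 2 + 2 from rfl,
          show 2 + 2 * n = 2 * n + 2 by ring, show 2 + n = n + 2 by ring] at h0 h1 ⊢
        norm_num at h0 h1 ⊢
        linear_combination (1 + X ^ (n + 2) + X ^ (2 * n + 4)) *
          ((1 - X ^ (n + 2)) * (1 - X ^ (n + 3))) * h0 +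
          X ^ (n + 2) * (1 - X ^ (n + 1)) * (1 - X ^ (n + 2)) * h1
    · obtain rfl : n = k + j := by omega
      have h0 := ih k j rfl
      rw [tripleCoeff]
      -- For j = 0 and j = 1 some neighbours lie beyond the range k ≤ n and vanish.
      rcases j with _ | _ | j
      · rw [tripleCoeff_of_lt R _ (k + 1) (by omega), tripleCoeff_of_lt R _ (k + 2) (by omega)]
        rw [triangle_succ]
        simp only [eulerProd_succ, eulerProd_zero, mul_zero, add_zero, mul_one, mul_add] at h0 ⊢
        linear_combination X ^ (k + 1) * (1 - X ^ (2 * k + 1 + 1)) * (1 - X ^ (2 * k + 2 + 1)) * h0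
      · have h1 := ih (k + 1) 0 (by omega)
        rw [show 2 * (k + 1) + 0 + 1 = 2 * k + 3 by ring, triangle_succ] at h1
        rw [show 2 * k + (0 + 1) + 1 = 2 * k + 2 by ring,
          show 2 * k + 2 * (0 + 1) + 1 = 2 * k + 3 by ring] at h0
        rw [tripleCoeff_of_lt R _ (k + 2) (by omega), triangle_succ,
          show 2 * (k + 1) + (0 + 1) + 1 = 2 * k + 4 by ring,
          eulerProd_succ R (2 * k + 4), eulerProd_succ R (2 * k + 3)]
        rw [eulerProd_succ R (2 * k + 2)] at h0 h1 ⊢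
        simp only [eulerProd_succ R 0, eulerProd_zero] at h0 h1 ⊢
        linear_combination X ^ (k + 2) * (1 - X ^ (2 * k + 3)) * (1 - X ^ (2 * k + 4)) * h0 +
          (1 + X ^ (2 * k + 4)) * (1 - X) * (1 - X ^ (2 * k + 4)) * h1
      · have h1 := ih (k + 1) (j + 1) (by omega)
        have h2 := ih (k + 2) j (by omega)
        rw [show 2 * k + (j + 1 + 1) + 1 = 2 * k + j + 3 by ring,
          show 2 * k + 2 * (j + 1 + 1) + 1 = 2 * k + 2 * j + 5 by ring,
          eulerProd_succ R (j + 1), eulerProd_succ R j] at h0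
        rw [show 2 * (k + 1) + (j + 1) + 1 = 2 * k + j + 3 + 1 by ring,
          show 2 * (k + 1) + 2 * (j + 1) + 1 = 2 * k + 2 * j + 5 by ring, triangle_succ,
          eulerProd_succ R j, eulerProd_succ R (2 * k + j + 3)] at h1
        rw [show 2 * (k + 2) + j + 1 = 2 * k + j + 3 + 1 + 1 by ring,
          show 2 * (k + 2) + 2 * j + 1 = 2 * k + 2 * j + 5 by ring, triangle_succ, triangle_succ,
          eulerProd_succ R (2 * k + j + 3 + 1), eulerProd_succ R (2 * k + j + 3)] at h2
        rw [show 2 * (k + 1) + (j + 1 + 1) + 1 = 2 * k + j + 3 + 1 + 1 by ring,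
          show 2 * (k + 1) + 2 * (j + 1 + 1) + 1 = 2 * k + 2 * j + 5 + 1 + 1 by ring,
          triangle_succ, eulerProd_succ R (2 * k + j + 3 + 1), eulerProd_succ R (2 * k + j + 3),
          eulerProd_succ R (2 * k + 2 * j + 5 + 1), eulerProd_succ R (2 * k + 2 * j + 5),
          eulerProd_succ R (j + 1), eulerProd_succ R j]
        linear_combination X ^ (k + j + 3) * (1 - X ^ (2 * k + j + 4)) *
            (1 - X ^ (2 * k + j + 5)) * h0 +
          (1 + X ^ (2 * (k + j) + 6)) * (1 - X ^ (j + 2)) * (1 - X ^ (2 * k + j + 5)) * h1 +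
          X ^ (k + j + 3) * (1 - X ^ (j + 1)) * (1 - X ^ (j + 2)) * h2

/-- The model is w k = (z^k + z^(-k-1))/(1 + z⁻¹) and s = z + z⁻¹; then `h0` is the recurrence at k
= -1, where w(-1) = w 0. With the factor 1 + z⁻¹ already divided out, z = -1 is allowed without
differentiating. -/
theorem sum_mul_tripleCoeff_succ {w : ℕ → R⟦X⟧} {s : R⟦X⟧} (h0 : w 0 + w 1 = s * w 0)
    (hw : ∀ k, w k + w (k + 2) = s * w (k + 1)) (n : ℕ) :
    ∑ k ∈ range (n + 2), w k * tripleCoeff R (n + 1) k =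
      (1 + s * X ^ (n + 1) + X ^ (2 * n + 2)) * ∑ k ∈ range (n + 1), w k * tripleCoeff R n k := by
  have e1 : ∑ k ∈ range (n + 1), w (k + 1) * tripleCoeff R n (k + 1) =
      ∑ k ∈ range n, w (k + 1) * tripleCoeff R n (k + 1) := by
    rw [sum_range_succ, tripleCoeff_of_lt R n (n + 1) (by omega), mul_zero, add_zero]
  have e2 : ∑ k ∈ range (n + 1), w (k + 1) * tripleCoeff R n (k + 2) =
      ∑ k ∈ range n, w k * tripleCoeff R n (k + 1) - w 0 * tripleCoeff R n 1 := by
    have := sum_range_succ' (fun k => w k * tripleCoeff R n (k + 1)) (n + 1)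
    rw [sum_range_succ, sum_range_succ, tripleCoeff_of_lt R n (n + 1) (by omega),
      tripleCoeff_of_lt R n (n + 2) (by omega)] at this
    linear_combination -this
  have e3 : ∑ k ∈ range n, w (k + 2) * tripleCoeff R n (k + 1) =
      s * ∑ k ∈ range n, w (k + 1) * tripleCoeff R n (k + 1) -
        ∑ k ∈ range n, w k * tripleCoeff R n (k + 1) := by
    rw [mul_sum, ← sum_sub_distrib]
    exact sum_congr rfl fun k _ => by linear_combination tripleCoeff R n (k + 1) * hw k
  have e4 : ∑ k ∈ range (n + 1), w (k + 1) * tripleCoeff R n k =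
      ∑ k ∈ range n, w (k + 2) * tripleCoeff R n (k + 1) + w 1 * tripleCoeff R n 0 :=
    sum_range_succ' (fun k => w (k + 1) * tripleCoeff R n k) n
  have e5 : ∑ k ∈ range (n + 1), w (k + 1) * tripleCoeff R (n + 1) (k + 1) =
      X ^ (n + 1) * ∑ k ∈ range (n + 1), w (k + 1) * tripleCoeff R n k +
      (1 + X ^ (2 * n + 2)) * ∑ k ∈ range (n + 1), w (k + 1) * tripleCoeff R n (k + 1) +
      X ^ (n + 1) * ∑ k ∈ range (n + 1), w (k + 1) * tripleCoeff R n (k + 2) := by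
    simp only [mul_sum, ← sum_add_distrib]
    exact sum_congr rfl fun k _ => by rw [tripleCoeff]; ring
  rw [sum_range_succ' _ (n + 1), e5, e4, e3, e2, e1,
    sum_range_succ' (fun k => w k * tripleCoeff R n k) n, tripleCoeff]
  linear_combination X ^ (n + 1) * tripleCoeff R n 0 * h0

theorem sum_mul_tripleCoeff {w : ℕ → R⟦X⟧} {s : R⟦X⟧} (hone : w 0 = 1) (h0 : w 0 + w 1 = s * w 0)
    (hw : ∀ k, w k + w (k + 2) = s * w (k + 1)) (n : ℕ) :
    ∑ k ∈ range (n + 1), w k * tripleCoeff R n k =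
      ∏ i ∈ range n, (1 + s * X ^ (i + 1) + X ^ (2 * i + 2)) := by
  induction n with
  | zero => simp [tripleCoeff, hone]
  | succ n ih => rw [sum_mul_tripleCoeff_succ R h0 hw, ih, prod_range_succ, mul_comm]

/-- With j = n - k, the quotient of Euler products times E is 1 only modulo q^(j+1); the k missing
orders come from the factor q^(k(k+1)/2), as k ≤ k(k+1)/2. -/
theorem modXPow_pentagonalSeries_mul_tripleCoeff {n k : ℕ} (hk : k ≤ n) :
    modXPow (n + 1) (pentagonalSeries R * tripleCoeff R n k) =
      modXPow (n + 1) (X ^ (k * (k + 1) / 2)) := by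
  obtain ⟨j, rfl⟩ := Nat.exists_eq_add_of_le hk
  obtain ⟨u, hu⟩ := (isUnit_eulerProd R j).exists_right_inv
  obtain ⟨v, hv⟩ := (isUnit_eulerProd R (2 * k + j + 1)).exists_right_inv
  have hA : tripleCoeff R (k + j) k =
      X ^ (k * (k + 1) / 2) * (eulerProd R (2 * k + 2 * j + 1) * u * v) := by
    linear_combination u * v * tripleCoeff_mul_eulerProd R (k + j) k j rfl -
      tripleCoeff R (k + j) k * hu -
      tripleCoeff R (k + j) k * eulerProd R j * u * hv
  have hmod : modXPow (j + 1)
      (pentagonalSeries R * (eulerProd R (2 * k + 2 * j + 1) * u * v)) = modXPow (j + 1) 1 := by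
    have h1 := modXPow_pentagonalSeries R (le_refl j)
    have h2 := modXPow_pentagonalSeries R (show j ≤ 2 * k + j + 1 by omega)
    have h3 := modXPow_pentagonalSeries R (show j ≤ 2 * k + 2 * j + 1 by omega)
    have hu' := congrArg (modXPow (j + 1)) hu
    have hv' := congrArg (modXPow (j + 1)) hv
    simp only [map_mul, map_one] at hu' hv' ⊢
    rw [← h1] at hu'
    rw [← h2] at hv'
    rw [← h3]
    linear_combination hu' + modXPow (j + 1) (pentagonalSeries R) * modXPow (j + 1) u * hv'
  rw [modXPow_eq_iff_dvd] at hmod ⊢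
  rw [hA, show pentagonalSeries R * (X ^ (k * (k + 1) / 2) *
    (eulerProd R (2 * k + 2 * j + 1) * u * v)) - X ^ (k * (k + 1) / 2) =
    X ^ (k * (k + 1) / 2) *
      (pentagonalSeries R * (eulerProd R (2 * k + 2 * j + 1) * u * v) - 1) by ring]
  refine dvd_trans (pow_dvd_pow X (?_ : k + j + 1 ≤ k * (k + 1) / 2 + (j + 1))) ?_
  · have := le_triangle k
    omega
  · rw [pow_add]
    exact mul_dvd_mul_left _ hmod

theorem modXPow_pentagonalSeries_mul_prod {w : ℕ → R⟦X⟧} {s : R⟦X⟧} (hone : w 0 = 1)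
    (h0 : w 0 + w 1 = s * w 0) (hw : ∀ k, w k + w (k + 2) = s * w (k + 1)) (n : ℕ) :
    modXPow (n + 1) (pentagonalSeries R * ∏ i ∈ range n, (1 + s * X ^ (i + 1) + X ^ (2 * i + 2))) =
      modXPow (n + 1) (∑ k ∈ range (n + 1), w k * X ^ (k * (k + 1) / 2)) := by
  rw [← sum_mul_tripleCoeff R hone h0 hw, mul_sum, map_sum, map_sum]
  refine sum_congr rfl fun k hk => ?_
  rw [mul_left_comm, map_mul,
    modXPow_pentagonalSeries_mul_tripleCoeff R (Nat.lt_succ_iff.mp (mem_range.mp hk)), map_mul]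

end TripleProduct

/-! ### The identities of Jacobi and Gauss -/

section Specializations

variable (R : Type*) [CommRing R]

theorem coeff_sum_C_mul_X_pow_triangle (c : ℕ → R) {n m : ℕ} (hmn : m ≤ n) :
    (∀ k, m = k * (k + 1) / 2 →
      coeff m (∑ k ∈ range (n + 1), C (c k) * X ^ (k * (k + 1) / 2) : R⟦X⟧) = c k) ∧
    ((∀ k, m ≠ k * (k + 1) / 2) →
      coeff m (∑ k ∈ range (n + 1), C (c k) * X ^ (k * (k + 1) / 2) : R⟦X⟧) = 0) := by
  simp only [map_sum, coeff_C_mul_X_pow]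
  refine ⟨?_, fun h => sum_eq_zero fun k _ => if_neg (h k)⟩
  rintro k hk
  rw [sum_eq_single k, if_pos hk]
  · intro l _ hl
    exact if_neg fun h => hl (triangle_injective (h.symm.trans hk))
  · intro h
    have := le_triangle k
    rw [mem_range] at h
    omega

/-- **Jacobi's identity** for the cube of the Euler product. -/
theorem coeff_pentagonalSeries_pow_three (m : ℕ) :
    (∀ k : ℕ, m = k * (k + 1) / 2 →
      coeff m (pentagonalSeries R ^ 3) = ((-1) ^ k * (2 * (k : R) + 1) : R)) ∧
    ((∀ k : ℕ, m ≠ k * (k + 1) / 2) → coeff m (pentagonalSeries R ^ 3) = 0) := by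
  have hC : (C 2 : R⟦X⟧) = 2 := map_ofNat C 2
  -- The case z = -1: the recurrence with s = -2 has the solution (-1)^k (2k+1).
  have h := modXPow_pentagonalSeries_mul_prod R
    (w := fun k => C ((-1) ^ k * (2 * (k : R) + 1))) (s := -2) (by simp)
    (by simp [hC]) (fun k => by simp [hC]; ring) m
  have h2 : ∏ i ∈ range m, (1 + -2 * X ^ (i + 1) + X ^ (2 * i + 2) : R⟦X⟧) =
      eulerProd R m ^ 2 := by
    rw [eulerProd, ← prod_pow]
    exact prod_congr rfl fun i _ => by ring
  rw [h2, map_mul, map_pow, ← modXPow_pentagonalSeries R le_rfl, ← map_pow, ← map_mul,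
    ← pow_succ'] at h
  rw [modXPow_eq_iff.mp h m (Nat.lt_succ_self m)]
  exact coeff_sum_C_mul_X_pow_triangle R _ le_rfl

/-- The generating function `∑ q^(k (k + 1) / 2)` of the triangular numbers. -/
noncomputable def triangleSeries : R⟦X⟧ :=
  open Classical in PowerSeries.mk fun m => if ∃ k, m = k * (k + 1) / 2 then 1 else 0

/-- **Gauss's identity** for the generating function of the triangular numbers. -/
theorem pentagonalSeries_mul_triangleSeries :
    pentagonalSeries R * triangleSeries R = expand 2 two_ne_zero (pentagonalSeries R) ^ 2 := by
  refine eq_of_forall_modXPow fun n => ?_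
  -- The case z = 1: s = 2 with a constant solution.
  have h := modXPow_pentagonalSeries_mul_prod R (w := fun _ => C 1) (s := 2) (by simp)
    (by simp; norm_num) (fun k => by simp; norm_num) n
  have h1 : modXPow (n + 1) (triangleSeries R) =
      modXPow (n + 1) (∑ k ∈ range (n + 1), C 1 * X ^ (k * (k + 1) / 2)) := by
    rw [modXPow_eq_iff]
    intro m hm
    have := coeff_sum_C_mul_X_pow_triangle R (fun _ => 1) (Nat.lt_succ_iff.mp hm)
    rw [triangleSeries, coeff_mk]
    split_ifs with hk
    · obtain ⟨k, hk⟩ := hk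
      exact (this.1 k hk).symm
    · exact (this.2 fun k hk' => hk ⟨k, hk'⟩).symm
  have h2 : eulerProd R n ^ 2 * ∏ i ∈ range n, (1 + 2 * X ^ (i + 1) + X ^ (2 * i + 2) : R⟦X⟧) =
      expand 2 two_ne_zero (eulerProd R n) ^ 2 := by
    simp only [eulerProd, map_prod, ← prod_pow, ← prod_mul_distrib]
    exact prod_congr rfl fun i _ => by simp; ring
  rw [map_mul, h1, ← h, map_pow, modXPow_expand two_ne_zero (modXPow_pentagonalSeries R le_rfl),
    ← map_pow, ← h2]
  simp only [map_mul, map_pow, modXPow_pentagonalSeries R (le_refl n)]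
  ring

end Specializations

/-! ### Generating functions of weighted multisets -/

section WeightedMultisets

variable {α : Type*} (w : α → ℕ)

/-- The multisets supported on `S` whose elements have total weight `n`. -/
def multisetsOfWeight (S : Finset α) (n : ℕ) : Set (Multiset α) :=
  {m | (∀ x ∈ m, x ∈ S) ∧ (m.map w).sum = n}

variable {w}

/-- Either x is absent or one copy of it can be removed; on generating functions this is
multiplication by 1/(1 - q^(w x)). -/
theorem multisetsOfWeight_insert [DecidableEq α] {S : Finset α} (x : α) (n : ℕ) :
    multisetsOfWeight w (insert x S) n = multisetsOfWeight w S n ∪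
      {m | w x ≤ n ∧ m ∈ (x ::ₘ ·) '' multisetsOfWeight w (insert x S) (n - w x)} := by
  ext m
  simp only [multisetsOfWeight, Set.mem_union, Set.mem_ofPred_eq, Set.mem_image, mem_insert]
  constructor
  · rintro ⟨h1, h2⟩
    by_cases hx : x ∈ m
    · obtain ⟨m, rfl⟩ := Multiset.exists_cons_of_mem hx
      rw [Multiset.map_cons, Multiset.sum_cons] at h2
      exact Or.inr ⟨by omega, m, ⟨fun y hy => h1 y (Multiset.mem_cons_of_mem hy), by omega⟩, rfl⟩
    · exact Or.inl ⟨fun y hy => (h1 y hy).resolve_left fun h => hx (h ▸ hy), h2⟩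
  · rintro (⟨h1, h2⟩ | ⟨hle, m, ⟨h1, h2⟩, rfl⟩)
    · exact ⟨fun y hy => Or.inr (h1 y hy), h2⟩
    · refine ⟨fun y hy => ?_, ?_⟩
      · rcases Multiset.mem_cons.mp hy with h | h
        · exact Or.inl h
        · exact h1 y h
      · rw [Multiset.map_cons, Multiset.sum_cons, h2]
        omega

theorem multisetsOfWeight_empty (n : ℕ) :
    multisetsOfWeight w ∅ n = if n = 0 then {0} else ∅ := by
  ext m
  simp only [multisetsOfWeight, Set.mem_ofPred_eq, notMem_empty]
  constructor
  · rintro ⟨h1, h2⟩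
    obtain rfl := Multiset.eq_zero_of_forall_notMem h1
    have : n = 0 := by simpa using h2.symm
    simp [this]
  · split_ifs with h
    · rintro rfl
      simp [h]
    · simp

theorem finite_multisetsOfWeight (S : Finset α) (hw : ∀ x ∈ S, 0 < w x) (n : ℕ) :
    (multisetsOfWeight w S n).Finite := by
  classical
  induction S using Finset.induction_on generalizing n with
  | empty =>
    rw [multisetsOfWeight_empty]
    split_ifs <;> simp
  | insert x S _ ih =>
    have hx := hw x (mem_insert_self x S)
    induction n using Nat.strong_induction_on with
    | _ n ihn =>
      rw [multisetsOfWeight_insert]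
      refine (ih (fun y hy => hw y (mem_insert_of_mem hy)) n).union ?_
      by_cases hle : w x ≤ n
      · exact ((ihn (n - w x) (by omega)).image _).subset fun m hm => hm.2
      · simp [hle]

theorem ncard_multisetsOfWeight_insert [DecidableEq α] {S : Finset α} {x : α} (hx : x ∉ S)
    (hw : ∀ y ∈ insert x S, 0 < w y) (n : ℕ) :
    (multisetsOfWeight w (insert x S) n).ncard = (multisetsOfWeight w S n).ncard +
      if w x ≤ n then (multisetsOfWeight w (insert x S) (n - w x)).ncard else 0 := by
  have hS := finite_multisetsOfWeight S (fun y hy => hw y (mem_insert_of_mem hy)) n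
  split_ifs with hle
  · have hI := finite_multisetsOfWeight (insert x S) hw (n - w x)
    conv_lhs => rw [multisetsOfWeight_insert]
    simp only [hle, true_and, Set.ofPred_mem_eq]
    rw [Set.ncard_union_eq _ hS (hI.image _),
      Set.ncard_image_of_injective _ (fun a b h => (Multiset.cons_inj_right x).mp h)]
    rw [Set.disjoint_left]
    rintro _ hm ⟨m, _, rfl⟩
    exact hx (hm.1 x (Multiset.mem_cons_self x m))
  · rw [multisetsOfWeight_insert]
    simp [hle]

theorem mk_ncard_multisetsOfWeight_mul_prod (R : Type*) [CommRing R] (S : Finset α)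
    (hw : ∀ x ∈ S, 0 < w x) :
    (PowerSeries.mk fun n => ((multisetsOfWeight w S n).ncard : R)) *
      ∏ x ∈ S, (1 - X ^ w x) = 1 := by
  classical
  induction S using Finset.induction_on with
  | empty =>
    ext n
    simp only [multisetsOfWeight_empty, prod_empty, mul_one, coeff_mk, coeff_one]
    split_ifs <;> simp
  | insert x S hx ih =>
    rw [prod_insert hx, ← mul_assoc]
    refine Eq.trans ?_ (ih fun y hy => hw y (mem_insert_of_mem hy))
    congr 1
    ext n
    rw [mul_sub, mul_one, map_sub, mul_comm _ (X ^ w x), coeff_X_pow_mul']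
    simp only [coeff_mk]
    rw [ncard_multisetsOfWeight_insert hx hw n]
    split_ifs <;> simp

end WeightedMultisets

/-! ### The product formula for generalized cubic partitions -/

section CubicPartitions

variable (R : Type*) [CommRing R]

/-- The colored parts of size at most `N` that may occur in a generalized cubic partition. -/
def coloredParts (d N : ℕ) : Finset (ℕ × ℕ) :=
  (Icc 1 N ×ˢ range (d + 1)).filter fun x => x.2 < partColors d x.1

theorem partColors_le (d m : ℕ) : partColors d m ≤ d + 1 := by
  unfold partColors
  split_ifs <;> omega

theorem mem_coloredParts {d N : ℕ} {x : ℕ × ℕ} :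
    x ∈ coloredParts d N ↔ x.1 ∈ Icc 1 N ∧ x.2 ∈ range (partColors d x.1) := by
  have := partColors_le d x.1
  simp only [coloredParts, mem_filter, mem_product, mem_range]
  constructor
  · rintro ⟨⟨h1, _⟩, h2⟩
    exact ⟨h1, h2⟩
  · rintro ⟨h1, h2⟩
    exact ⟨⟨h1, by omega⟩, h2⟩

/-- No part exceeds n, so a finite supply of colored parts suffices; the freedom in N lets one
supply serve all coefficients of a truncation. -/
theorem cubicPartitionCount_eq_ncard {d n N : ℕ} (hn : n ≤ N) :
    cubicPartitionCount d n = (multisetsOfWeight Prod.fst (coloredParts d N) n).ncard := by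
  rw [cubicPartitionCount, ← Nat.card_coe_set_eq]
  refine Nat.card_congr
    { toFun := fun p => ⟨p.parts, fun x hx => ?_, p.size_sum⟩
      invFun := fun m => ⟨m.1, fun x hx => ?_, fun x hx => ?_, m.2.2⟩
      left_inv := fun p => rfl
      right_inv := fun m => rfl }
  · have hle := Multiset.le_sum_of_mem (Multiset.mem_map_of_mem Prod.fst hx)
    rw [p.size_sum] at hle
    have h1 := p.size_pos x hx
    have h2 := p.color_lt x hx
    rw [mem_coloredParts, mem_Icc, mem_range]
    exact ⟨⟨h1, hle.trans hn⟩, h2⟩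
  · exact (mem_Icc.mp (mem_coloredParts.mp (m.2.1 x hx)).1).1
  · exact mem_range.mp (mem_coloredParts.mp (m.2.1 x hx)).2

theorem prod_coloredParts (d N : ℕ) :
    ∏ x ∈ coloredParts d N, (1 - X ^ x.1 : R⟦X⟧) =
      ∏ i ∈ range N, (1 - X ^ (i + 1)) ^ partColors d (i + 1) := by
  rw [prod_finset_product (coloredParts d N) (Icc 1 N) (fun i => range (partColors d i))
    fun x => mem_coloredParts]
  simp only [prod_const, card_range]
  rw [range_eq_Ico, prod_Ico_add' (fun i => (1 - X ^ i : R⟦X⟧) ^ partColors d i) 0 N 1]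
  rfl

theorem prod_pow_partColors {d : ℕ} (hd : 1 ≤ d) (M : ℕ) :
    ∏ i ∈ range (2 * M), (1 - X ^ (i + 1) : R⟦X⟧) ^ partColors d (i + 1) =
      eulerProd R (2 * M) * expand 2 two_ne_zero (eulerProd R M) ^ (d - 1) := by
  obtain ⟨e, rfl⟩ := Nat.exists_eq_add_of_le' hd
  induction M with
  | zero => simp [eulerProd_zero]
  | succ M ih =>
    rw [Nat.mul_succ, prod_range_succ, prod_range_succ, ih, eulerProd_succ, eulerProd_succ,
      eulerProd_succ]
    have h1 : partColors (e + 1) (2 * M + 1) = 1 := if_neg (by simp)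
    have h2 : partColors (e + 1) (2 * M + 1 + 1) = e + 1 := if_pos ⟨M + 1, by ring⟩
    rw [h1, h2]
    simp only [map_mul, map_sub, map_one, map_pow, expand_X, Nat.add_sub_cancel, ← pow_mul,
      mul_pow]
    ring

/-- The generating function of the generalized cubic partitions. -/
noncomputable def cubicPartitionSeries (d : ℕ) : R⟦X⟧ :=
  PowerSeries.mk fun n => (cubicPartitionCount d n : R)

theorem cubicPartitionSeries_mul {d : ℕ} (hd : 1 ≤ d) :
    cubicPartitionSeries R d *
      (pentagonalSeries R * expand 2 two_ne_zero (pentagonalSeries R) ^ (d - 1)) = 1 := by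
  refine eq_of_forall_modXPow fun M => ?_
  have h1 : modXPow (M + 1) (cubicPartitionSeries R d) = modXPow (M + 1) (PowerSeries.mk fun n =>
      ((multisetsOfWeight Prod.fst (coloredParts d (2 * M)) n).ncard : R)) := by
    rw [modXPow_eq_iff]
    intro m hm
    rw [cubicPartitionSeries, coeff_mk, coeff_mk,
      cubicPartitionCount_eq_ncard (show m ≤ 2 * M by omega)]
  rw [map_mul, h1, map_mul, modXPow_pentagonalSeries R (show M ≤ 2 * M by omega), map_pow,
    modXPow_expand two_ne_zero (modXPow_pentagonalSeries R le_rfl), ← map_pow, ← map_mul,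
    ← prod_pow_partColors R hd, ← prod_coloredParts, ← map_mul,
    mk_ncard_multisetsOfWeight_mul_prod]
  intro x hx
  exact (mem_Icc.mp (mem_coloredParts.mp hx).1).1

end CubicPartitions

/-! ### Signed representations by 2x² + 3y² -/

section BinaryForm

/-- On the residue class `1` modulo `6`, the even character modulo `12`. -/
def sign12 (x : ℤ) : ℤ := if x % 12 = 1 then 1 else -1

/-- The solutions of `2 x ^ 2 + 3 y ^ 2 = M` with `x ≡ 1 (mod 6)` and `y` odd. -/
noncomputable def formSolutions (M : ℕ) : Finset (ℤ × ℤ) :=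
  (Icc (-M : ℤ) M ×ˢ Icc (-M : ℤ) M).filter fun v =>
    v.1 % 6 = 1 ∧ v.2 % 2 = 1 ∧ 2 * v.1 ^ 2 + 3 * v.2 ^ 2 = M

theorem abs_le_of_sq_le {x M : ℤ} (h : x ^ 2 ≤ M) : -M ≤ x ∧ x ≤ M := by
  constructor <;> nlinarith [sq_nonneg x, sq_nonneg (x + 1), sq_nonneg (x - 1)]

theorem mem_formSolutions {M : ℕ} {v : ℤ × ℤ} : v ∈ formSolutions M ↔
    v.1 % 6 = 1 ∧ v.2 % 2 = 1 ∧ 2 * v.1 ^ 2 + 3 * v.2 ^ 2 = M := by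
  simp only [formSolutions, mem_filter, mem_product, mem_Icc, and_iff_right_iff_imp]
  rintro ⟨_, _, h⟩
  exact ⟨abs_le_of_sq_le (by nlinarith [sq_nonneg v.1, sq_nonneg v.2]),
    abs_le_of_sq_le (by nlinarith [sq_nonneg v.1, sq_nonneg v.2])⟩

/-- Conjugating x√2 + y√-3 and multiplying by (a + t√-6)/p, a number of norm 1, is a reflection
preserving the form. Where it is integral it is an involution of the solutions, and by `hcong` it
reverses the sign. -/
theorem sum_sign12_filter_eq_zero {p a t : ℤ} (hp : p ≠ 0) (hnorm : a ^ 2 + 6 * t ^ 2 = p ^ 2)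
    (hdual : ∀ x y, p ∣ a * x + 3 * t * y → p ∣ 2 * t * x - a * y)
    (hcong : ∀ x y x', x % 6 = 1 → y % 2 = 1 → p * x' = a * x + 3 * t * y →
      x' % 6 = 1 ∧ sign12 x + sign12 x' = 0)
    (hpar : ∀ x y y', y % 2 = 1 → p * y' = 2 * t * x - a * y → y' % 2 = 1) (M : ℕ) :
    ∑ v ∈ formSolutions M with p ∣ a * v.1 + 3 * t * v.2, sign12 v.1 = 0 := by
  have key : ∀ v ∈ (formSolutions M).filter fun v => p ∣ a * v.1 + 3 * t * v.2,
      ∃ x' y' : ℤ, (a * v.1 + 3 * t * v.2) / p = x' ∧ (2 * t * v.1 - a * v.2) / p = y' ∧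
        p * x' = a * v.1 + 3 * t * v.2 ∧ p * y' = 2 * t * v.1 - a * v.2 ∧
        a * x' + 3 * t * y' = p * v.1 ∧ 2 * t * x' - a * y' = p * v.2 := by
    rintro ⟨x, y⟩ hv
    obtain ⟨x', hx'⟩ := (mem_filter.mp hv).2
    obtain ⟨y', hy'⟩ := hdual x y ⟨x', hx'⟩
    refine ⟨x', y', ?_, ?_, hx'.symm, hy'.symm, ?_, ?_⟩
    · exact Int.ediv_eq_of_eq_mul_right hp hx'
    · exact Int.ediv_eq_of_eq_mul_right hp hy'
    · refine mul_left_cancel₀ hp ?_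
      simp only at hx' hy' ⊢
      linear_combination -a * hx' - 3 * t * hy' + x * hnorm
    · refine mul_left_cancel₀ hp ?_
      simp only at hx' hy' ⊢
      linear_combination -2 * t * hx' + a * hy' + y * hnorm
  refine sum_involution
    (fun v _ => ((a * v.1 + 3 * t * v.2) / p, (2 * t * v.1 - a * v.2) / p)) ?_ ?_ ?_ ?_
  · intro v hv
    obtain ⟨x', y', hx, hy, hx', hy', -, -⟩ := key v hv
    obtain ⟨h1, h2, -⟩ := mem_formSolutions.mp (mem_filter.mp hv).1
    simp only [hx]
    exact (hcong _ _ _ h1 h2 hx').2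
  · intro v hv h0 heq
    obtain ⟨x', y', hx, hy, hx', hy', -, -⟩ := key v hv
    obtain ⟨h1, h2, -⟩ := mem_formSolutions.mp (mem_filter.mp hv).1
    have h3 := (hcong _ _ _ h1 h2 hx').2
    have h4 : x' = v.1 := by rw [← hx]; exact congrArg Prod.fst heq
    rw [h4] at h3
    omega
  · intro v hv
    obtain ⟨x', y', hx, hy, hx', hy', hx2, -⟩ := key v hv
    obtain ⟨h1, h2, h3⟩ := mem_formSolutions.mp (mem_filter.mp hv).1
    simp only [hx, hy, mem_filter, mem_formSolutions]
    refine ⟨⟨(hcong _ _ _ h1 h2 hx').1, hpar _ _ _ h2 hy', ?_⟩, ⟨v.1, hx2⟩⟩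
    refine mul_left_cancel₀ (pow_ne_zero 2 hp) ?_
    linear_combination 2 * (p * x' + a * v.1 + 3 * t * v.2) * hx' +
      3 * (p * y' + 2 * t * v.1 - a * v.2) * hy' + p ^ 2 * h3 +
      (2 * v.1 ^ 2 + 3 * v.2 ^ 2) * hnorm
  · intro v hv
    obtain ⟨x', y', hx, hy, hx', hy', hx2, hy2⟩ := key v hv
    simp only [hx, hy, hx2, hy2]
    ext
    · exact Int.mul_ediv_cancel_left _ hp
    · exact Int.mul_ediv_cancel_left _ hp

/-- Inclusion–exclusion: the domains of the reflections for t and -t cover all solutions, each has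
signed sum 0, and they meet exactly where p divides both coordinates. -/
theorem sum_sign12_eq_neg {p a t : ℤ} (hp : p ≠ 0) (hnorm : a ^ 2 + 6 * t ^ 2 = p ^ 2) {M : ℕ}
    (hdual : ∀ s, s = t ∨ s = -t → ∀ x y, p ∣ a * x + 3 * s * y → p ∣ 2 * s * x - a * y)
    (hcong : ∀ s, s = t ∨ s = -t → ∀ x y x', x % 6 = 1 → y % 2 = 1 →
      p * x' = a * x + 3 * s * y → x' % 6 = 1 ∧ sign12 x + sign12 x' = 0)
    (hpar : ∀ s, s = t ∨ s = -t → ∀ x y y', y % 2 = 1 → p * y' = 2 * s * x - a * y → y' % 2 = 1)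
    (hcover : ∀ x y : ℤ, 2 * x ^ 2 + 3 * y ^ 2 = M →
      p ∣ a * x + 3 * t * y ∨ p ∣ a * x + 3 * (-t) * y)
    (hinter : ∀ x y, p ∣ a * x + 3 * t * y → p ∣ a * x + 3 * (-t) * y → p ∣ x ∧ p ∣ y) :
    ∑ v ∈ formSolutions M, sign12 v.1 =
      -∑ v ∈ formSolutions M with p ∣ v.1 ∧ p ∣ v.2, sign12 v.1 := by
  have h1 := sum_sign12_filter_eq_zero hp hnorm (hdual t (Or.inl rfl)) (hcong t (Or.inl rfl))
    (hpar t (Or.inl rfl)) M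
  have h2 := sum_sign12_filter_eq_zero hp (t := -t) (by rw [neg_sq]; exact hnorm)
    (hdual _ (Or.inr rfl)) (hcong _ (Or.inr rfl)) (hpar _ (Or.inr rfl)) M
  have h3 := sum_union_inter (s₁ := (formSolutions M).filter fun v => p ∣ a * v.1 + 3 * t * v.2)
    (s₂ := (formSolutions M).filter fun v => p ∣ a * v.1 + 3 * (-t) * v.2)
    (f := fun v => sign12 v.1)
  have hU : ((formSolutions M).filter fun v => p ∣ a * v.1 + 3 * t * v.2) ∪
      ((formSolutions M).filter fun v => p ∣ a * v.1 + 3 * (-t) * v.2) = formSolutions M := by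
    rw [← filter_or]
    exact filter_true_of_mem fun v hv => hcover _ _ (mem_formSolutions.mp hv).2.2
  have hI : ((formSolutions M).filter fun v => p ∣ a * v.1 + 3 * t * v.2) ∩
      ((formSolutions M).filter fun v => p ∣ a * v.1 + 3 * (-t) * v.2) =
      (formSolutions M).filter fun v => p ∣ v.1 ∧ p ∣ v.2 := by
    rw [← filter_and]
    refine filter_congr fun v _ => ⟨fun h => hinter _ _ h.1 h.2, fun h => ?_⟩
    exact ⟨dvd_add (h.1.mul_left _) (h.2.mul_left _), dvd_add (h.1.mul_left _) (h.2.mul_left _)⟩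
  rw [hU, hI, h1, h2] at h3
  linarith

/-- The unit e = ±1 is chosen so that scaling x by e·p preserves the normalisation x ≡ 1 mod 6. -/
theorem sum_sign12_filter_dvd {p : ℕ} {e : ℤ} (hp : p ≠ 0) (he : e ^ 2 = 1)
    (hcong : ∀ x : ℤ, x % 6 = 1 ↔ (e * p * x) % 6 = 1) (hpar : ∀ y : ℤ, y % 2 = 1 ↔ (p * y) % 2 = 1)
    (M : ℕ) :
    ∑ v ∈ formSolutions (p ^ 2 * M) with (p : ℤ) ∣ v.1 ∧ (p : ℤ) ∣ v.2, sign12 v.1 =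
      ∑ v ∈ formSolutions M, sign12 (e * p * v.1) := by
  have hp' : (p : ℤ) ≠ 0 := by exact_mod_cast hp
  have he0 : e ≠ 0 := by rintro rfl; norm_num at he
  symm
  refine sum_bij (fun v _ => (e * p * v.1, p * v.2)) ?_ ?_ ?_ ?_
  · intro v hv
    obtain ⟨h1, h2, h3⟩ := mem_formSolutions.mp hv
    rw [mem_filter, mem_formSolutions]
    refine ⟨⟨(hcong _).mp h1, (hpar _).mp h2, ?_⟩, ⟨e * v.1, by ring⟩, ⟨v.2, rfl⟩⟩
    push_cast
    linear_combination (p : ℤ) ^ 2 * h3 + 2 * p ^ 2 * v.1 ^ 2 * he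
  · intro v _ u _ h
    obtain ⟨h1, h2⟩ := Prod.mk.inj h
    ext
    · exact mul_left_cancel₀ (mul_ne_zero he0 hp') h1
    · exact mul_left_cancel₀ hp' h2
  · rintro ⟨x, y⟩ hv
    obtain ⟨hv, ⟨x', hx⟩, ⟨y', hy⟩⟩ := mem_filter.mp hv
    obtain ⟨h1, h2, h3⟩ := mem_formSolutions.mp hv
    simp only at hx hy h1 h2 h3
    have hx2 : e * p * (e * x') = x := by rw [hx]; linear_combination (p : ℤ) * x' * he
    refine ⟨(e * x', y'), mem_formSolutions.mpr ⟨?_, ?_, ?_⟩, ?_⟩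
    · rw [hcong, hx2]
      exact h1
    · rw [hpar, ← hy]
      exact h2
    · refine mul_left_cancel₀ (pow_ne_zero 2 hp') ?_
      rw [hx, hy] at h3
      push_cast at h3
      linear_combination h3 + 2 * p ^ 2 * x' ^ 2 * he
    · simp only [hx2, hy]
  · intro v _
    rfl

theorem filter_dvd_eq_empty {p M : ℕ} (h : ¬ p ^ 2 ∣ M) :
    ((formSolutions M).filter fun v => (p : ℤ) ∣ v.1 ∧ (p : ℤ) ∣ v.2) = ∅ := by
  rw [filter_eq_empty_iff]
  rintro ⟨x, y⟩ hv ⟨⟨x', hx⟩, ⟨y', hy⟩⟩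
  obtain ⟨-, -, h3⟩ := mem_formSolutions.mp hv
  simp only at hx hy h3
  rw [hx, hy] at h3
  apply h
  have : (p : ℤ) ^ 2 ∣ M := ⟨2 * x' ^ 2 + 3 * y' ^ 2, by rw [← h3]; ring⟩
  exact_mod_cast this

theorem sum_sign12_seven {M : ℕ} (hM : 7 ∣ M) :
    ∑ v ∈ formSolutions M, sign12 v.1 =
      if 49 ∣ M then ∑ v ∈ formSolutions (M / 49), sign12 v.1 else 0 := by
  -- -5 + 2√-6 = (1 + √-6)², and 1 + √-6 has norm 7.
  rw [sum_sign12_eq_neg (p := 7) (a := -5) (t := 2) (by norm_num) (by norm_num)]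
  · split_ifs with h
    · obtain ⟨M, rfl⟩ := h
      -- Scaling by 7 exchanges the classes 1 and 7 mod 12, so the minus sign cancels.
      have := sum_sign12_filter_dvd (p := 7) (e := 1) (by norm_num) (by norm_num)
        (fun x => by push_cast; omega) (fun x => by push_cast; omega) M
      norm_num at this ⊢
      rw [this, ← sum_neg_distrib]
      refine sum_congr rfl fun v hv => ?_
      have := (mem_formSolutions.mp hv).1
      unfold sign12
      split_ifs <;> omega
    · have := filter_dvd_eq_empty (p := 7) (M := M) (by norm_num; exact h)
      push_cast at this
      rw [this, sum_empty, neg_zero]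
  · rintro s (rfl | rfl) x y h <;> omega
  -- As y is odd, 7x' = -5x ± 6y forces x' ≡ x + 6 mod 12.
  · rintro s (rfl | rfl) x y x' h1 h2 h3 <;> unfold sign12 <;>
      exact ⟨by omega, by split_ifs <;> omega⟩
  · rintro s (rfl | rfl) x y y' h1 h2 <;> omega
  · intro x y h
    -- The product is 25x² - 36y² ≡ 2(2x² + 3y²) mod 7.
    have h1 : (7 : ℤ) ∣ (-5 * x + 3 * 2 * y) * (-5 * x + 3 * (-2) * y) := by
      obtain ⟨k, rfl⟩ := hM
      push_cast at h
      exact ⟨2 * k + 3 * x ^ 2 - 6 * y ^ 2, by linear_combination 2 * h⟩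
    exact (show Prime (7 : ℤ) by norm_num).dvd_or_dvd h1
  · intro x y h1 h2
    omega

theorem sum_sign12_eleven {M : ℕ} (hM : 11 ∣ M) :
    ∑ v ∈ formSolutions M, sign12 v.1 =
      if 121 ∣ M then -∑ v ∈ formSolutions (M / 121), sign12 v.1 else 0 := by
  -- (2√2 + √-3)² = 5 + 4√-6, where 11 = 2·2² + 3·1²; the sign of t is immaterial.
  rw [sum_sign12_eq_neg (p := 11) (a := 5) (t := -4) (by norm_num) (by norm_num)]
  · split_ifs with h
    · obtain ⟨M, rfl⟩ := h
      -- Since -11 ≡ 1 mod 12, scaling keeps the sign and the minus survives.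
      have := sum_sign12_filter_dvd (p := 11) (e := -1) (by norm_num) (by norm_num)
        (fun x => by push_cast; omega) (fun x => by push_cast; omega) M
      norm_num at this ⊢
      rw [this]
      refine sum_congr rfl fun v hv => ?_
      have := (mem_formSolutions.mp hv).1
      unfold sign12
      split_ifs <;> omega
    · have := filter_dvd_eq_empty (p := 11) (M := M) (by norm_num; exact h)
      push_cast at this
      rw [this, sum_empty, neg_zero]
  · rintro s (rfl | rfl) x y h <;> omega
  -- Modulo 12, 11x' = 5x ± 12y gives x' ≡ 7x ≡ x + 6, as x is odd.
  · rintro s (rfl | rfl) x y x' h1 h2 h3 <;> unfold sign12 <;>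
      exact ⟨by omega, by split_ifs <;> omega⟩
  · rintro s (rfl | rfl) x y y' h1 h2 <;> omega
  · intro x y h
    have h1 : (11 : ℤ) ∣ (5 * x + 3 * (-4) * y) * (5 * x + 3 * (- -4) * y) := by
      obtain ⟨k, rfl⟩ := hM
      push_cast at h
      exact ⟨7 * k + x ^ 2 - 15 * y ^ 2, by linear_combination 7 * h⟩
    exact (show Prime (11 : ℤ) by norm_num).dvd_or_dvd h1
  · intro x y h1 h2
    omega

end BinaryForm

/-! ### The theta series of the form -/

section ThetaProduct

variable (R : Type*) [CommRing R]

/-- The theta series `∏ (1 - q^(2i))³ / (1 - q^i)` attached to the form `2 x ^ 2 + 3 y ^ 2`. -/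
noncomputable def thetaProduct : R⟦X⟧ :=
  expand 2 two_ne_zero (pentagonalSeries R) * triangleSeries R

/-- By Euler, the exponents are i = k(3k-1) and x = 1 - 6k satisfies x² = 12i + 1; x ≡ 1 mod 6
selects one of ±x, and `sign12` records (-1)^k. A bound B independent of i allows sums to be
exchanged later. -/
theorem coeff_expand_pentagonalSeries {i : ℕ} {B : ℤ} (hB : 12 * i + 1 ≤ B) :
    coeff i (expand 2 two_ne_zero (pentagonalSeries R)) =
      ∑ x ∈ Icc (-B) B, if x % 6 = 1 ∧ x ^ 2 = 12 * i + 1 then (sign12 x : R) else 0 := by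
  by_cases h : ∃ k : ℤ, i = 2 * pentagonal k
  · obtain ⟨k, rfl⟩ := h
    have hk := two_mul_natCast_pentagonal k
    rw [coeff_expand_mul, coeff_pentagonalSeries_pentagonal, sum_eq_single (1 - 6 * k), if_pos]
    · unfold sign12
      rcases Int.even_or_odd k with hk | hk
      · rw [Int.negOnePow_even k hk, if_pos (by obtain ⟨l, rfl⟩ := hk; omega)]
        simp
      · rw [Int.negOnePow_odd k hk, if_neg (by obtain ⟨l, rfl⟩ := hk; omega)]
        simp
    · refine ⟨by omega, ?_⟩
      push_cast
      linear_combination -12 * hk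
    · intro x _ hx
      refine if_neg ?_
      rintro ⟨h1, h2⟩
      push_cast at h2
      have h3 : (x - (1 - 6 * k)) * (x + (1 - 6 * k)) = 0 := by linear_combination h2 + 12 * hk
      rcases mul_eq_zero.mp h3 with h3 | h3 <;> omega
    · intro hx
      refine absurd (mem_Icc.mpr (abs_le_of_sq_le (le_trans (le_of_eq ?_) hB))) hx
      push_cast
      linear_combination -12 * hk
  · have h0 : coeff i (expand 2 two_ne_zero (pentagonalSeries R)) = 0 := by
      rw [coeff_expand]
      split_ifs with hi
      · obtain ⟨i, rfl⟩ := hi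
        rw [Nat.mul_div_cancel_left _ two_pos]
        refine coeff_pentagonalSeries_eq_zero R ?_
        rintro ⟨k, rfl⟩
        exact h ⟨k, rfl⟩
      · rfl
    rw [h0]
    refine (sum_eq_zero fun x _ => if_neg ?_).symm
    rintro ⟨h1, h2⟩
    have h3 := two_mul_natCast_pentagonal (-(x / 6))
    have h4 : x = 6 * (x / 6) + 1 := by omega
    refine h ⟨-(x / 6), ?_⟩
    have h5 : 12 * (2 * (pentagonal (-(x / 6)) : ℤ)) = 12 * i := by
      generalize x / 6 = z at *
      subst h4
      linear_combination 12 * h3 + h2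
    omega

/-- The exponent k(k+1)/2 corresponds to both y = ±(2k+1), whence the factor 2. -/
theorem two_mul_coeff_triangleSeries {j : ℕ} {B : ℤ} (hB : 8 * j + 1 ≤ B) :
    2 * coeff j (triangleSeries R) =
      ∑ y ∈ Icc (-B) B, if y % 2 = 1 ∧ y ^ 2 = 8 * j + 1 then (1 : R) else 0 := by
  rw [triangleSeries, coeff_mk, ← sum_filter]
  split_ifs with h
  · obtain ⟨k, hk⟩ := h
    have hk2 : (2 * j : ℤ) = k * (k + 1) := by
      have : 2 * j = k * (k + 1) := by
        rw [hk]
        exact Nat.mul_div_cancel' (Nat.even_mul_succ_self k).two_dvd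
      exact_mod_cast this
    have : ((Icc (-B) B).filter fun y : ℤ => y % 2 = 1 ∧ y ^ 2 = 8 * (j : ℤ) + 1) =
        {2 * (k : ℤ) + 1, -(2 * (k : ℤ) + 1)} := by
      ext y
      simp only [mem_filter, mem_insert, mem_singleton]
      constructor
      · rintro ⟨-, -, h2⟩
        have h3 : (y - (2 * k + 1)) * (y + (2 * k + 1)) = 0 := by linear_combination h2 + 4 * hk2
        rcases mul_eq_zero.mp h3 with h3 | h3
        · left; omega
        · right; omega
      · intro hy
        have h2 : y ^ 2 = 8 * j + 1 := by
          rcases hy with rfl | rfl <;> linear_combination -4 * hk2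
        exact ⟨mem_Icc.mpr (abs_le_of_sq_le (h2.trans_le hB)), by omega, h2⟩
    rw [this, sum_const, card_pair (by omega)]
    simp
  · rw [filter_false_of_mem]
    · simp
    rintro y _ ⟨h1, h2⟩
    have habs : ((y.natAbs : ℤ)) ^ 2 = 8 * j + 1 := by rw [Int.natAbs_sq]; exact h2
    obtain ⟨k, hk⟩ : ∃ k, y.natAbs = 2 * k + 1 := ⟨y.natAbs / 2, by omega⟩
    refine h ⟨k, ?_⟩
    rw [hk] at habs
    have : 2 * j = k * (k + 1) := by
      push_cast at habs
      zify
      linarith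
    omega

theorem two_mul_coeff_thetaProduct (N : ℕ) :
    2 * coeff N (thetaProduct R) = ((∑ v ∈ formSolutions (24 * N + 5), sign12 v.1 : ℤ) : R) := by
  set B : ℤ := ((24 * N + 5 : ℕ) : ℤ) with hB
  have h1 : ∀ ij ∈ antidiagonal N, 2 * (coeff ij.1 (expand 2 two_ne_zero (pentagonalSeries R)) *
      coeff ij.2 (triangleSeries R)) = ∑ v ∈ Icc (-B) B ×ˢ Icc (-B) B,
        if (v.1 % 6 = 1 ∧ v.1 ^ 2 = 12 * (ij.1 : ℤ) + 1) ∧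
          (v.2 % 2 = 1 ∧ v.2 ^ 2 = 8 * (ij.2 : ℤ) + 1) then (sign12 v.1 : R) else 0 := by
    rintro ⟨i, j⟩ hij
    rw [HasAntidiagonal.mem_antidiagonal] at hij
    simp only at hij
    rw [mul_left_comm, coeff_expand_pentagonalSeries R (B := B) (by omega),
      two_mul_coeff_triangleSeries R (B := B) (by omega), sum_mul_sum, sum_product]
    simp only [ite_and, mul_ite, mul_one, mul_zero]
    refine sum_congr rfl fun x _ => sum_congr rfl fun y _ => ?_
    split_ifs <;> rfl
  rw [thetaProduct, coeff_mul, mul_sum, sum_congr rfl h1, sum_comm, formSolutions, sum_filter,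
    Int.cast_sum]
  refine sum_congr rfl fun v _ => ?_
  rw [Int.cast_ite, Int.cast_zero]
  split_ifs with h
  · obtain ⟨h2, h3, h4⟩ := h
    have h5 : (v.1 ^ 2) % 12 = 1 := by
      have : v.1 % 12 = 1 ∨ v.1 % 12 = 7 := by omega
      rcases this with h | h <;> simp [pow_two, Int.mul_emod, h]
    have h6 : (v.2 ^ 2) % 8 = 1 := by
      have : v.2 % 8 = 1 ∨ v.2 % 8 = 3 ∨ v.2 % 8 = 5 ∨ v.2 % 8 = 7 := by omega
      rcases this with h | h | h | h <;> simp [pow_two, Int.mul_emod, h]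
    have h7 := sq_nonneg v.1
    have h8 := sq_nonneg v.2
    rw [sum_eq_single ((v.1 ^ 2 / 12).toNat, (v.2 ^ 2 / 8).toNat), if_pos]
    · refine ⟨⟨h2, ?_⟩, h3, ?_⟩ <;> simp only <;> omega
    · rintro ⟨i, j⟩ hij hne
      refine if_neg ?_
      rintro ⟨⟨-, h9⟩, -, h10⟩
      simp only at h9 h10
      refine hne (Prod.ext ?_ ?_) <;> simp only <;> omega
    · intro hn
      refine absurd (HasAntidiagonal.mem_antidiagonal.mpr ?_) hn
      simp only
      omega
  · refine sum_eq_zero fun ij hij => if_neg ?_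
    rw [HasAntidiagonal.mem_antidiagonal] at hij
    rintro ⟨⟨h2, h3⟩, h4, h5⟩
    refine h ⟨h2, h4, ?_⟩
    rw [h3, h5]
    omega

end ThetaProduct

/-! ### Extracting residue classes of exponents -/

section Dissection

variable {R : Type*} [CommRing R]

/-- The series `∑ f_{pn+r} q^n` attached to `∑ f_n q^n`. -/
noncomputable def dissect (p r : ℕ) (f : R⟦X⟧) : R⟦X⟧ :=
  PowerSeries.mk fun n => coeff (p * n + r) f

theorem coeff_dissect (p r n : ℕ) (f : R⟦X⟧) : coeff n (dissect p r f) = coeff (p * n + r) f :=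
  coeff_mk _ _

theorem dissect_expand_mul {p r : ℕ} (hp : p ≠ 0) (hr : r < p) (g f : R⟦X⟧) :
    dissect p r (expand p hp g * f) = g * dissect p r f := by
  ext n
  rw [coeff_dissect, coeff_mul, coeff_mul]
  symm
  refine sum_of_injOn (fun ij => (p * ij.1, p * ij.2 + r)) ?_ ?_ ?_ ?_
  · rintro ⟨i, j⟩ _ ⟨k, l⟩ _ h
    obtain ⟨h1, h2⟩ := Prod.mk.inj h
    exact Prod.ext (Nat.eq_of_mul_eq_mul_left (Nat.pos_of_ne_zero hp) h1)
      (Nat.eq_of_mul_eq_mul_left (Nat.pos_of_ne_zero hp) (Nat.add_right_cancel h2))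
  · rintro ⟨i, j⟩ hij
    rw [mem_coe, HasAntidiagonal.mem_antidiagonal] at hij ⊢
    simp only at hij ⊢
    rw [← hij]
    ring
  · rintro ⟨i, j⟩ hij hn
    rw [HasAntidiagonal.mem_antidiagonal] at hij
    by_cases hi : p ∣ i
    · obtain ⟨k, rfl⟩ := hi
      refine absurd ⟨(k, n - k), ?_, ?_⟩ hn
      · have hk : k < n + 1 := by
          refine Nat.lt_of_mul_lt_mul_left (a := p) ?_
          rw [Nat.mul_succ]
          simp only at hij
          omega
        rw [mem_coe, HasAntidiagonal.mem_antidiagonal]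
        simp only
        omega
      · simp only at hij ⊢
        refine Prod.ext rfl ?_
        simp only
        have hk : k < n + 1 := by
          refine Nat.lt_of_mul_lt_mul_left (a := p) ?_
          rw [Nat.mul_succ]
          omega
        obtain ⟨l, rfl⟩ := Nat.exists_eq_add_of_le (Nat.lt_succ_iff.mp hk)
        rw [Nat.add_sub_cancel_left]
        rw [mul_add] at hij
        omega
    · rw [coeff_expand_of_not_dvd p hp g hi, zero_mul]
  · rintro ⟨i, j⟩ _
    rw [coeff_expand_mul, coeff_dissect]

theorem expand_zmod (p : ℕ) [Fact p.Prime] (hp : p ≠ 0) (f : (ZMod p)⟦X⟧) :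
    expand p hp f = f ^ p := by
  have h : MvPowerSeries.map (frobenius (ZMod p) p) (MvPowerSeries.expand p hp f) = f ^ p :=
    MvPowerSeries.map_frobenius_expand p hp
  rw [ZMod.frobenius_zmod, MvPowerSeries.map_id] at h
  exact h

/-- The part of a power series supported on the exponents congruent to `c` modulo `p`. -/
noncomputable def classPart (p c : ℕ) (f : R⟦X⟧) : R⟦X⟧ :=
  PowerSeries.mk fun n => if n % p = c then coeff n f else 0

theorem classPart_eq_zero {p c : ℕ} {f : R⟦X⟧} (h : ∀ n, n % p = c → coeff n f = 0) :
    classPart p c f = 0 := by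
  ext n
  rw [classPart, coeff_mk, map_zero]
  split_ifs with hn
  · exact h n hn
  · rfl

theorem coeff_eq_zero_of_classPart_eq_zero {p c : ℕ} {f : R⟦X⟧} (h : classPart p c f = 0) {n : ℕ}
    (hn : n % p = c) : coeff n f = 0 := by
  have := congrArg (coeff n) h
  rwa [classPart, coeff_mk, if_pos hn, map_zero] at this

theorem classPart_mul {p c : ℕ} (hc : c < p) (f g : R⟦X⟧) :
    classPart p c (f * g) =
      ∑ i ∈ range p, classPart p i f * classPart p ((c + p - i) % p) g := by
  ext n
  have hp : 0 < p := Nat.zero_lt_of_lt hc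
  have key : ∀ a b : ℕ, b % p = (c + p - a % p) % p ↔ (a + b) % p = c := by
    intro a b
    have ha := Nat.mod_lt a hp
    have h1 : (b % p = (c + p - a % p) % p) ↔ b + a % p ≡ c + p - a % p + a % p [MOD p] :=
      ⟨fun h => Nat.ModEq.add_right _ h, fun h => Nat.ModEq.add_right_cancel' _ h⟩
    rw [h1, Nat.sub_add_cancel (by omega), Nat.ModEq, Nat.add_mod_right, Nat.mod_eq_of_lt hc,
      Nat.add_mod_mod, add_comm b a]
  simp only [map_sum, coeff_mul, classPart, coeff_mk]
  rw [sum_comm]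
  split_ifs with hn
  · refine sum_congr rfl fun ab hab => ?_
    rw [HasAntidiagonal.mem_antidiagonal] at hab
    rw [sum_eq_single (ab.1 % p), if_pos rfl, if_pos ((key _ _).mpr (hab ▸ hn))]
    · intro i _ hi
      rw [if_neg (Ne.symm hi), zero_mul]
    · exact fun h => absurd (mem_range.mpr (Nat.mod_lt _ hp)) h
  · refine (sum_eq_zero fun ab hab => sum_eq_zero fun i _ => ?_).symm
    rw [HasAntidiagonal.mem_antidiagonal] at hab
    beta_reduce
    by_cases hi : ab.1 % p = i
    · subst hi
      rw [if_neg fun h => hn (hab ▸ (key _ _).mp h), mul_zero]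
    · rw [if_neg hi, zero_mul]

theorem classPart_mul_expand {p : ℕ} (c : ℕ) (hp : p ≠ 0) (f g : R⟦X⟧) :
    classPart p c (f * expand p hp g) = classPart p c f * expand p hp g := by
  ext n
  have h : ∀ ab ∈ antidiagonal n, coeff ab.1 (classPart p c f) * coeff ab.2 (expand p hp g) =
      if n % p = c then coeff ab.1 f * coeff ab.2 (expand p hp g) else 0 := by
    rintro ⟨a, b⟩ hab
    rw [HasAntidiagonal.mem_antidiagonal] at hab
    by_cases hb : p ∣ b
    · obtain ⟨k, rfl⟩ := hb
      rw [← hab, Nat.add_mul_mod_self_left, classPart, coeff_mk, ite_mul, zero_mul]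
    · simp [coeff_expand_of_not_dvd p hp g hb]
  rw [coeff_mul, sum_congr rfl h, classPart, coeff_mk, coeff_mul]
  split_ifs <;> simp

end Dissection

/-! ### The modulus 11: class components of a seventh power -/

/-- A septic form is congruent modulo `11` to a combination of five quartic forms. -/
theorem septic_eq_zero_of_quartics_eq_zero {R : Type*} [CommRing R] (h11 : (11 : R) = 0)
    (a0 a1 a3 a6 a10 : R)
    (h3 : 4 * a0 ^ 3 * a3 + 4 * a0 * a1 ^ 3 + 24 * a0 * a1 * a3 * a10 + 6 * a1 ^ 2 * a6 ^ 2 + 12 *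
      a3 * a6 ^ 2 * a10 + 4 * a6 * a10 ^ 3 = 0)
    (h6 : 4 * a0 ^ 3 * a6 + 6 * a0 ^ 2 * a3 ^ 2 + 24 * a0 * a1 * a6 * a10 + 4 * a1 ^ 3 * a3 + 12 *
      a1 * a3 ^ 2 * a10 + 4 * a6 ^ 3 * a10 = 0)
    (h8 : 12 * a0 * a1 ^ 2 * a6 + 24 * a0 * a3 * a6 * a10 + 4 * a0 * a10 ^ 3 + 6 * a1 ^ 2 * a3 ^ 2 +
      4 * a1 * a6 ^ 3 + 4 * a3 ^ 3 * a10 = 0)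
    (h9 : 12 * a0 ^ 2 * a3 * a6 + 6 * a0 ^ 2 * a10 ^ 2 + 4 * a0 * a3 ^ 3 + 4 * a1 ^ 3 * a6 + 24 * a1
      * a3 * a6 * a10 + 4 * a1 * a10 ^ 3 = 0)
    (h10 : 4 * a0 ^ 3 * a10 + 24 * a0 * a1 * a3 * a6 + 12 * a0 * a1 * a10 ^ 2 + 4 * a1 * a3 ^ 3 + 4 *
      a3 * a6 ^ 3 + 6 * a6 ^ 2 * a10 ^ 2 = 0) :
    7 * a0 ^ 6 * a6 + 21 * a0 ^ 5 * a3 ^ 2 + 210 * a0 ^ 4 * a1 * a6 * a10 + 140 * a0 ^ 3 * a1 ^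
    3 * a3 + 420 * a0 ^ 3 * a1 * a3 ^ 2 * a10 + 140 * a0 ^ 3 * a6 ^ 3 * a10 + 630 * a0 ^ 2 * a1
    ^ 2 * a3 * a6 ^ 2 + 630 * a0 ^ 2 * a1 ^ 2 * a6 * a10 ^ 2 + 630 * a0 ^ 2 * a3 ^ 2 * a6 ^ 2 *
    a10 + 420 * a0 ^ 2 * a3 * a6 * a10 ^ 3 + 21 * a0 ^ 2 * a10 ^ 5 + 7 * a0 * a1 ^ 6 + 210 * a0
    * a1 ^ 4 * a3 * a10 + 420 * a0 * a1 ^ 2 * a3 ^ 3 * a6 + 630 * a0 * a1 ^ 2 * a3 ^ 2 * a10 ^ 2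
    + 210 * a0 * a1 * a3 * a6 ^ 4 + 420 * a0 * a1 * a6 ^ 3 * a10 ^ 2 + 210 * a0 * a3 ^ 4 * a6 *
    a10 + 140 * a0 * a3 ^ 3 * a10 ^ 3 + 21 * a1 ^ 5 * a6 ^ 2 + 420 * a1 ^ 3 * a3 * a6 ^ 2 * a10
    + 140 * a1 ^ 3 * a6 * a10 ^ 3 + 21 * a1 ^ 2 * a3 ^ 5 + 140 * a1 * a3 ^ 3 * a6 ^ 3 + 630 * a1
    * a3 ^ 2 * a6 ^ 2 * a10 ^ 2 + 210 * a1 * a3 * a6 * a10 ^ 4 + 7 * a1 * a10 ^ 6 + 7 * a3 ^ 6 *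
    a10 + 7 * a3 * a6 ^ 6 + 21 * a6 ^ 5 * a10 ^ 2 = 0 := by
  -- Giving a_i weight i mod 11, the cofactor of each quartic is a cubic whose weight brings the
  -- product to weight 6; the last term collects the multiples of 11.
  linear_combination
    (4 * (a0 ^ 2 * a3) - (a1 ^ 3) - (a1 * a3 * a10)) * h3 +
    (-(a0 ^ 3) - (a0 * a1 * a10) + 4 * (a6 ^ 2 * a10)) * h6 +
    (-(a0 * a3 * a6) + 4 * (a0 * a10 ^ 2) - (a3 ^ 3)) * h8 +
    (4 * (a1 ^ 2 * a6) - (a3 * a6 * a10) - (a10 ^ 3)) * h9 +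
    (-(a0 * a1 * a6) + 4 * (a1 * a3 ^ 2) - (a6 ^ 3)) * h10 +
    (a0 ^ 6 * a6 + a0 ^ 5 * a3 ^ 2 + 22 * a0 ^ 4 * a1 * a6 * a10 + 12 * a0 ^ 3 * a1 ^ 3 * a3 + 30
    * a0 ^ 3 * a1 * a3 ^ 2 * a10 + 12 * a0 ^ 3 * a6 ^ 3 * a10 + 54 * a0 ^ 2 * a1 ^ 2 * a3 * a6 ^
    2 + 54 * a0 ^ 2 * a1 ^ 2 * a6 * a10 ^ 2 + 54 * a0 ^ 2 * a3 ^ 2 * a6 ^ 2 * a10 + 30 * a0 ^ 2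
    * a3 * a6 * a10 ^ 3 + a0 ^ 2 * a10 ^ 5 + a0 * a1 ^ 6 + 22 * a0 * a1 ^ 4 * a3 * a10 + 30 * a0
    * a1 ^ 2 * a3 ^ 3 * a6 + 54 * a0 * a1 ^ 2 * a3 ^ 2 * a10 ^ 2 + 22 * a0 * a1 * a3 * a6 ^ 4 +
    30 * a0 * a1 * a6 ^ 3 * a10 ^ 2 + 22 * a0 * a3 ^ 4 * a6 * a10 + 12 * a0 * a3 ^ 3 * a10 ^ 3 +
    a1 ^ 5 * a6 ^ 2 + 30 * a1 ^ 3 * a3 * a6 ^ 2 * a10 + 12 * a1 ^ 3 * a6 * a10 ^ 3 + a1 ^ 2 * a3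
    ^ 5 + 12 * a1 * a3 ^ 3 * a6 ^ 3 + 54 * a1 * a3 ^ 2 * a6 ^ 2 * a10 ^ 2 + 22 * a1 * a3 * a6 *
    a10 ^ 4 + a1 * a10 ^ 6 + a3 ^ 6 * a10 + a3 * a6 ^ 6 + a6 ^ 5 * a10 ^ 2) * h11

section Eleven

variable {R : Type*} [CommRing R]

/-- Meant for J = E³, which modulo 11 has only the components 0, 1, 3, 6, 10. The components of J²,
J³, J⁴ are computed in turn to expose the quartic relations and the septic form. -/
theorem classPart_six_pow_seven (h11 : (11 : R⟦X⟧) = 0) {J : R⟦X⟧}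
    (hJ : ∀ c ∈ ({2, 4, 5, 7, 8, 9} : Finset ℕ), classPart 11 c J = 0)
    (hJ4 : ∀ c ∈ ({3, 6, 8, 9, 10} : Finset ℕ), classPart 11 c (J ^ 4) = 0) :
    classPart 11 6 (J ^ 7) = 0 := by
  have j2 := hJ 2 (by decide)
  have j4 := hJ 4 (by decide)
  have j5 := hJ 5 (by decide)
  have j7 := hJ 7 (by decide)
  have j8 := hJ 8 (by decide)
  have j9 := hJ 9 (by decide)
  set a0 := classPart 11 0 J with ha0
  set a1 := classPart 11 1 J with ha1
  set a3 := classPart 11 3 J with ha3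
  set a6 := classPart 11 6 J with ha6
  set a10 := classPart 11 10 J with ha10
  have s0 : classPart 11 0 (J * J) = a0 ^ 2 + 2 * a1 * a10 := by
    rw [classPart_mul (by norm_num)]
    simp only [sum_range_succ, range_zero, sum_empty, Nat.reduceAdd, Nat.reduceSub, Nat.reduceMod,
      j2, j4, j5, j7, j8, j9, ← ha0, ← ha1, ← ha3, ← ha6, ← ha10]
    ring
  have s1 : classPart 11 1 (J * J) = 2 * a0 * a1 + a6 ^ 2 := by
    rw [classPart_mul (by norm_num)]
    simp only [sum_range_succ, range_zero, sum_empty, Nat.reduceAdd, Nat.reduceSub, Nat.reduceMod,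
      j2, j4, j5, j7, j8, j9, ← ha0, ← ha1, ← ha3, ← ha6, ← ha10]
    ring
  have s2 : classPart 11 2 (J * J) = a1 ^ 2 + 2 * a3 * a10 := by
    rw [classPart_mul (by norm_num)]
    simp only [sum_range_succ, range_zero, sum_empty, Nat.reduceAdd, Nat.reduceSub, Nat.reduceMod,
      j2, j4, j5, j7, j8, j9, ← ha0, ← ha1, ← ha3, ← ha6, ← ha10]
    ring
  have s3 : classPart 11 3 (J * J) = 2 * a0 * a3 := by
    rw [classPart_mul (by norm_num)]
    simp only [sum_range_succ, range_zero, sum_empty, Nat.reduceAdd, Nat.reduceSub, Nat.reduceMod,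
      j2, j4, j5, j7, j8, j9, ← ha0, ← ha1, ← ha3, ← ha6, ← ha10]
    ring
  have s4 : classPart 11 4 (J * J) = 2 * a1 * a3 := by
    rw [classPart_mul (by norm_num)]
    simp only [sum_range_succ, range_zero, sum_empty, Nat.reduceAdd, Nat.reduceSub, Nat.reduceMod,
      j2, j4, j5, j7, j8, j9, ← ha0, ← ha1, ← ha3, ← ha6, ← ha10]
    ring
  have s5 : classPart 11 5 (J * J) = 2 * a6 * a10 := by
    rw [classPart_mul (by norm_num)]
    simp only [sum_range_succ, range_zero, sum_empty, Nat.reduceAdd, Nat.reduceSub, Nat.reduceMod,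
      j2, j4, j5, j7, j8, j9, ← ha0, ← ha1, ← ha3, ← ha6, ← ha10]
    ring
  have s6 : classPart 11 6 (J * J) = 2 * a0 * a6 + a3 ^ 2 := by
    rw [classPart_mul (by norm_num)]
    simp only [sum_range_succ, range_zero, sum_empty, Nat.reduceAdd, Nat.reduceSub, Nat.reduceMod,
      j2, j4, j5, j7, j8, j9, ← ha0, ← ha1, ← ha3, ← ha6, ← ha10]
    ring
  have s7 : classPart 11 7 (J * J) = 2 * a1 * a6 := by
    rw [classPart_mul (by norm_num)]
    simp only [sum_range_succ, range_zero, sum_empty, Nat.reduceAdd, Nat.reduceSub, Nat.reduceMod,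
      j2, j4, j5, j7, j8, j9, ← ha0, ← ha1, ← ha3, ← ha6, ← ha10]
    ring
  have s8 : classPart 11 8 (J * J) = 0 := by
    rw [classPart_mul (by norm_num)]
    simp only [sum_range_succ, range_zero, sum_empty, Nat.reduceAdd, Nat.reduceSub, Nat.reduceMod,
      j2, j4, j5, j7, j8, j9, ← ha0, ← ha1, ← ha3, ← ha6, ← ha10]
    ring
  have s9 : classPart 11 9 (J * J) = 2 * a3 * a6 + a10 ^ 2 := by
    rw [classPart_mul (by norm_num)]
    simp only [sum_range_succ, range_zero, sum_empty, Nat.reduceAdd, Nat.reduceSub, Nat.reduceMod,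
      j2, j4, j5, j7, j8, j9, ← ha0, ← ha1, ← ha3, ← ha6, ← ha10]
    ring
  have s10 : classPart 11 10 (J * J) = 2 * a0 * a10 := by
    rw [classPart_mul (by norm_num)]
    simp only [sum_range_succ, range_zero, sum_empty, Nat.reduceAdd, Nat.reduceSub, Nat.reduceMod,
      j2, j4, j5, j7, j8, j9, ← ha0, ← ha1, ← ha3, ← ha6, ← ha10]
    ring
  have q0 : classPart 11 0 (J * J * (J * J)) = a0 ^ 4 + 12 * a0 ^ 2 * a1 * a10 + 12 * a0 * a6 ^ 2 * a10 + 12 * a1 ^ 2 * a3 * a6 + 6 * a1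
      ^ 2 * a10 ^ 2 + 12 * a3 ^ 2 * a6 * a10 + 4 * a3 * a10 ^ 3 := by
    rw [classPart_mul (by norm_num)]
    simp only [sum_range_succ, range_zero, sum_empty, Nat.reduceAdd, Nat.reduceSub, Nat.reduceMod,
      s0, s1, s2, s3, s4, s5, s6, s7, s8, s9, s10]
    ring
  have q1 : classPart 11 1 (J * J * (J * J)) = 4 * a0 ^ 3 * a1 + 6 * a0 ^ 2 * a6 ^ 2 + 12 * a0 * a1 ^ 2 * a10 + 12 * a0 * a3 ^ 2 * a6 +
      12 * a0 * a3 * a10 ^ 2 + 12 * a1 * a6 ^ 2 * a10 + a3 ^ 4 := by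
    rw [classPart_mul (by norm_num)]
    simp only [sum_range_succ, range_zero, sum_empty, Nat.reduceAdd, Nat.reduceSub, Nat.reduceMod,
      s0, s1, s2, s3, s4, s5, s6, s7, s8, s9, s10]
    ring
  have q2 : classPart 11 2 (J * J * (J * J)) = 6 * a0 ^ 2 * a1 ^ 2 + 12 * a0 ^ 2 * a3 * a10 + 12 * a0 * a1 * a6 ^ 2 + 4 * a1 ^ 3 * a10 +
      12 * a1 * a3 ^ 2 * a6 + 12 * a1 * a3 * a10 ^ 2 + a6 ^ 4 := by
    rw [classPart_mul (by norm_num)]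
    simp only [sum_range_succ, range_zero, sum_empty, Nat.reduceAdd, Nat.reduceSub, Nat.reduceMod,
      s0, s1, s2, s3, s4, s5, s6, s7, s8, s9, s10]
    ring
  have q3 : classPart 11 3 (J * J * (J * J)) = 4 * a0 ^ 3 * a3 + 4 * a0 * a1 ^ 3 + 24 * a0 * a1 * a3 * a10 + 6 * a1 ^ 2 * a6 ^ 2 + 12 *
      a3 * a6 ^ 2 * a10 + 4 * a6 * a10 ^ 3 := by
    rw [classPart_mul (by norm_num)]
    simp only [sum_range_succ, range_zero, sum_empty, Nat.reduceAdd, Nat.reduceSub, Nat.reduceMod,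
      s0, s1, s2, s3, s4, s5, s6, s7, s8, s9, s10]
    ring
  have q4 : classPart 11 4 (J * J * (J * J)) = 12 * a0 ^ 2 * a1 * a3 + 12 * a0 * a3 * a6 ^ 2 + 12 * a0 * a6 * a10 ^ 2 + a1 ^ 4 + 12 * a1
      ^ 2 * a3 * a10 + 4 * a3 ^ 3 * a6 + 6 * a3 ^ 2 * a10 ^ 2 := by
    rw [classPart_mul (by norm_num)]
    simp only [sum_range_succ, range_zero, sum_empty, Nat.reduceAdd, Nat.reduceSub, Nat.reduceMod,
      s0, s1, s2, s3, s4, s5, s6, s7, s8, s9, s10]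
    ring
  have q5 : classPart 11 5 (J * J * (J * J)) = 12 * a0 ^ 2 * a6 * a10 + 12 * a0 * a1 ^ 2 * a3 + 12 * a0 * a3 ^ 2 * a10 + 12 * a1 * a3 *
      a6 ^ 2 + 12 * a1 * a6 * a10 ^ 2 := by
    rw [classPart_mul (by norm_num)]
    simp only [sum_range_succ, range_zero, sum_empty, Nat.reduceAdd, Nat.reduceSub, Nat.reduceMod,
      s0, s1, s2, s3, s4, s5, s6, s7, s8, s9, s10]
    ring
  have q6 : classPart 11 6 (J * J * (J * J)) = 4 * a0 ^ 3 * a6 + 6 * a0 ^ 2 * a3 ^ 2 + 24 * a0 * a1 * a6 * a10 + 4 * a1 ^ 3 * a3 + 12 *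
      a1 * a3 ^ 2 * a10 + 4 * a6 ^ 3 * a10 := by
    rw [classPart_mul (by norm_num)]
    simp only [sum_range_succ, range_zero, sum_empty, Nat.reduceAdd, Nat.reduceSub, Nat.reduceMod,
      s0, s1, s2, s3, s4, s5, s6, s7, s8, s9, s10]
    ring
  have q7 : classPart 11 7 (J * J * (J * J)) = 12 * a0 ^ 2 * a1 * a6 + 12 * a0 * a1 * a3 ^ 2 + 4 * a0 * a6 ^ 3 + 12 * a1 ^ 2 * a6 * a10 +
      6 * a3 ^ 2 * a6 ^ 2 + 12 * a3 * a6 * a10 ^ 2 + a10 ^ 4 := by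
    rw [classPart_mul (by norm_num)]
    simp only [sum_range_succ, range_zero, sum_empty, Nat.reduceAdd, Nat.reduceSub, Nat.reduceMod,
      s0, s1, s2, s3, s4, s5, s6, s7, s8, s9, s10]
    ring
  have q8 : classPart 11 8 (J * J * (J * J)) = 12 * a0 * a1 ^ 2 * a6 + 24 * a0 * a3 * a6 * a10 + 4 * a0 * a10 ^ 3 + 6 * a1 ^ 2 * a3 ^ 2 +
      4 * a1 * a6 ^ 3 + 4 * a3 ^ 3 * a10 := by
    rw [classPart_mul (by norm_num)]
    simp only [sum_range_succ, range_zero, sum_empty, Nat.reduceAdd, Nat.reduceSub, Nat.reduceMod,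
      s0, s1, s2, s3, s4, s5, s6, s7, s8, s9, s10]
    ring
  have q9 : classPart 11 9 (J * J * (J * J)) = 12 * a0 ^ 2 * a3 * a6 + 6 * a0 ^ 2 * a10 ^ 2 + 4 * a0 * a3 ^ 3 + 4 * a1 ^ 3 * a6 + 24 * a1
      * a3 * a6 * a10 + 4 * a1 * a10 ^ 3 := by
    rw [classPart_mul (by norm_num)]
    simp only [sum_range_succ, range_zero, sum_empty, Nat.reduceAdd, Nat.reduceSub, Nat.reduceMod,
      s0, s1, s2, s3, s4, s5, s6, s7, s8, s9, s10]
    ring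
  have q10 : classPart 11 10 (J * J * (J * J)) = 4 * a0 ^ 3 * a10 + 24 * a0 * a1 * a3 * a6 + 12 * a0 * a1 * a10 ^ 2 + 4 * a1 * a3 ^ 3 + 4 *
      a3 * a6 ^ 3 + 6 * a6 ^ 2 * a10 ^ 2 := by
    rw [classPart_mul (by norm_num)]
    simp only [sum_range_succ, range_zero, sum_empty, Nat.reduceAdd, Nat.reduceSub, Nat.reduceMod,
      s0, s1, s2, s3, s4, s5, s6, s7, s8, s9, s10]
    ring
  have t0 : classPart 11 0 (J * J * J) = a0 ^ 3 + 6 * a0 * a1 * a10 + 3 * a6 ^ 2 * a10 := by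
    rw [classPart_mul (by norm_num)]
    simp only [sum_range_succ, range_zero, sum_empty, Nat.reduceAdd, Nat.reduceSub, Nat.reduceMod,
      s0, s1, s2, s3, s4, s5, s6, s7, s8, s9, s10, j2, j4, j5, j7, j8, j9,
      ← ha0, ← ha1, ← ha3, ← ha6, ← ha10]
    ring
  have t1 : classPart 11 1 (J * J * J) = 3 * a0 ^ 2 * a1 + 3 * a0 * a6 ^ 2 + 3 * a1 ^ 2 * a10 + 3 * a3 ^ 2 * a6 + 3 * a3 * a10 ^ 2 := by
    rw [classPart_mul (by norm_num)]
    simp only [sum_range_succ, range_zero, sum_empty, Nat.reduceAdd, Nat.reduceSub, Nat.reduceMod,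
      s0, s1, s2, s3, s4, s5, s6, s7, s8, s9, s10, j2, j4, j5, j7, j8, j9,
      ← ha0, ← ha1, ← ha3, ← ha6, ← ha10]
    ring
  have t2 : classPart 11 2 (J * J * J) = 3 * a0 * a1 ^ 2 + 6 * a0 * a3 * a10 + 3 * a1 * a6 ^ 2 := by
    rw [classPart_mul (by norm_num)]
    simp only [sum_range_succ, range_zero, sum_empty, Nat.reduceAdd, Nat.reduceSub, Nat.reduceMod,
      s0, s1, s2, s3, s4, s5, s6, s7, s8, s9, s10, j2, j4, j5, j7, j8, j9,
      ← ha0, ← ha1, ← ha3, ← ha6, ← ha10]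
    ring
  have t3 : classPart 11 3 (J * J * J) = 3 * a0 ^ 2 * a3 + a1 ^ 3 + 6 * a1 * a3 * a10 := by
    rw [classPart_mul (by norm_num)]
    simp only [sum_range_succ, range_zero, sum_empty, Nat.reduceAdd, Nat.reduceSub, Nat.reduceMod,
      s0, s1, s2, s3, s4, s5, s6, s7, s8, s9, s10, j2, j4, j5, j7, j8, j9,
      ← ha0, ← ha1, ← ha3, ← ha6, ← ha10]
    ring
  have t4 : classPart 11 4 (J * J * J) = 6 * a0 * a1 * a3 + 3 * a3 * a6 ^ 2 + 3 * a6 * a10 ^ 2 := by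
    rw [classPart_mul (by norm_num)]
    simp only [sum_range_succ, range_zero, sum_empty, Nat.reduceAdd, Nat.reduceSub, Nat.reduceMod,
      s0, s1, s2, s3, s4, s5, s6, s7, s8, s9, s10, j2, j4, j5, j7, j8, j9,
      ← ha0, ← ha1, ← ha3, ← ha6, ← ha10]
    ring
  have t5 : classPart 11 5 (J * J * J) = 6 * a0 * a6 * a10 + 3 * a1 ^ 2 * a3 + 3 * a3 ^ 2 * a10 := by
    rw [classPart_mul (by norm_num)]
    simp only [sum_range_succ, range_zero, sum_empty, Nat.reduceAdd, Nat.reduceSub, Nat.reduceMod,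
      s0, s1, s2, s3, s4, s5, s6, s7, s8, s9, s10, j2, j4, j5, j7, j8, j9,
      ← ha0, ← ha1, ← ha3, ← ha6, ← ha10]
    ring
  have t6 : classPart 11 6 (J * J * J) = 3 * a0 ^ 2 * a6 + 3 * a0 * a3 ^ 2 + 6 * a1 * a6 * a10 := by
    rw [classPart_mul (by norm_num)]
    simp only [sum_range_succ, range_zero, sum_empty, Nat.reduceAdd, Nat.reduceSub, Nat.reduceMod,
      s0, s1, s2, s3, s4, s5, s6, s7, s8, s9, s10, j2, j4, j5, j7, j8, j9,
      ← ha0, ← ha1, ← ha3, ← ha6, ← ha10]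
    ring
  have t7 : classPart 11 7 (J * J * J) = 6 * a0 * a1 * a6 + 3 * a1 * a3 ^ 2 + a6 ^ 3 := by
    rw [classPart_mul (by norm_num)]
    simp only [sum_range_succ, range_zero, sum_empty, Nat.reduceAdd, Nat.reduceSub, Nat.reduceMod,
      s0, s1, s2, s3, s4, s5, s6, s7, s8, s9, s10, j2, j4, j5, j7, j8, j9,
      ← ha0, ← ha1, ← ha3, ← ha6, ← ha10]
    ring
  have t8 : classPart 11 8 (J * J * J) = 3 * a1 ^ 2 * a6 + 6 * a3 * a6 * a10 + a10 ^ 3 := by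
    rw [classPart_mul (by norm_num)]
    simp only [sum_range_succ, range_zero, sum_empty, Nat.reduceAdd, Nat.reduceSub, Nat.reduceMod,
      s0, s1, s2, s3, s4, s5, s6, s7, s8, s9, s10, j2, j4, j5, j7, j8, j9,
      ← ha0, ← ha1, ← ha3, ← ha6, ← ha10]
    ring
  have t9 : classPart 11 9 (J * J * J) = 6 * a0 * a3 * a6 + 3 * a0 * a10 ^ 2 + a3 ^ 3 := by
    rw [classPart_mul (by norm_num)]
    simp only [sum_range_succ, range_zero, sum_empty, Nat.reduceAdd, Nat.reduceSub, Nat.reduceMod,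
      s0, s1, s2, s3, s4, s5, s6, s7, s8, s9, s10, j2, j4, j5, j7, j8, j9,
      ← ha0, ← ha1, ← ha3, ← ha6, ← ha10]
    ring
  have t10 : classPart 11 10 (J * J * J) = 3 * a0 ^ 2 * a10 + 6 * a1 * a3 * a6 + 3 * a1 * a10 ^ 2 := by
    rw [classPart_mul (by norm_num)]
    simp only [sum_range_succ, range_zero, sum_empty, Nat.reduceAdd, Nat.reduceSub, Nat.reduceMod,
      s0, s1, s2, s3, s4, s5, s6, s7, s8, s9, s10, j2, j4, j5, j7, j8, j9,
      ← ha0, ← ha1, ← ha3, ← ha6, ← ha10]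
    ring
  rw [show J ^ 4 = J * J * (J * J) by ring] at hJ4
  rw [show J ^ 7 = J * J * (J * J) * (J * J * J) by ring, classPart_mul (by norm_num)]
  simp only [sum_range_succ, range_zero, sum_empty, Nat.reduceAdd, Nat.reduceSub, Nat.reduceMod,
    q0, q1, q2, q3, q4, q5, q6, q7, q8, q9, q10, t0, t1, t2, t3, t4, t5, t6, t7, t8, t9, t10]
  refine Eq.trans ?_ (septic_eq_zero_of_quartics_eq_zero h11 a0 a1 a3 a6 a10
    (q3 ▸ hJ4 3 (by decide)) (q6 ▸ hJ4 6 (by decide)) (q8 ▸ hJ4 8 (by decide))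
    (q9 ▸ hJ4 9 (by decide)) (q10 ▸ hJ4 10 (by decide)))
  ring

end Eleven

/-! ### Vanishing coefficients of E^6 mod 7 and E^10 mod 11 -/

section EulerPowers

/-- For exponents k(k+1)/2 and l(l+1)/2 with sum 5 mod 7, (2k+1)² + (2l+1)² ≡ 0; as -1 is not a
square mod 7, Jacobi's coefficients vanish. -/
theorem coeff_pentagonalSeries_pow_six {m : ℕ} (hm : m % 7 = 5) :
    coeff m (pentagonalSeries (ZMod 7) ^ 6) = 0 := by
  rw [show 6 = 3 + 3 from rfl, pow_add, coeff_mul]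
  refine sum_eq_zero fun ij hij => ?_
  rw [HasAntidiagonal.mem_antidiagonal] at hij
  have h1 := coeff_pentagonalSeries_pow_three (ZMod 7) ij.1
  have h2 := coeff_pentagonalSeries_pow_three (ZMod 7) ij.2
  by_cases hk : ∃ k, ij.1 = k * (k + 1) / 2
  · by_cases hl : ∃ l, ij.2 = l * (l + 1) / 2
    · obtain ⟨k, hk⟩ := hk
      obtain ⟨l, hl⟩ := hl
      rw [h1.1 k hk, h2.1 l hl]
      have hk2 : 2 * ij.1 = k * (k + 1) := by
        rw [hk]
        exact Nat.mul_div_cancel' (Nat.even_mul_succ_self k).two_dvd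
      have hl2 : 2 * ij.2 = l * (l + 1) := by
        rw [hl]
        exact Nat.mul_div_cancel' (Nat.even_mul_succ_self l).two_dvd
      have hkl : (k : ZMod 7) * (k + 1) + l * (l + 1) = 3 := by
        have h3 : k * (k + 1) + l * (l + 1) = 7 * (2 * (m / 7) + 1) + 3 := by omega
        have h4 := congrArg (Nat.cast : ℕ → ZMod 7) h3
        push_cast at h4
        rw [h4, show (7 : ZMod 7) = 0 from rfl]
        ring
      have key : ∀ x y : ZMod 7, x * (x + 1) + y * (y + 1) = 3 → (2 * x + 1) * (2 * y + 1) = 0 := by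
        decide
      linear_combination (-1) ^ k * (-1) ^ l * key _ _ hkl
    · rw [h2.2 fun l h => hl ⟨l, h⟩, mul_zero]
  · rw [h1.2 fun k h => hk ⟨k, h⟩, zero_mul]

/-- Class 4 does contain triangular numbers, but only with 2k + 1 ≡ 0 mod 11; the other classes
contain none. -/
theorem classPart_pentagonalSeries_pow_three {c : ℕ}
    (hc : c ∈ ({2, 4, 5, 7, 8, 9} : Finset ℕ)) :
    classPart 11 c (pentagonalSeries (ZMod 11) ^ 3) = 0 := by
  refine classPart_eq_zero fun n hn => ?_
  have h := coeff_pentagonalSeries_pow_three (ZMod 11) n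
  by_cases hk : ∃ k, n = k * (k + 1) / 2
  · obtain ⟨k, hk⟩ := hk
    rw [h.1 k hk]
    have hk2 : 2 * n = k * (k + 1) := by
      rw [hk]
      exact Nat.mul_div_cancel' (Nat.even_mul_succ_self k).two_dvd
    have hk3 : (2 : ZMod 11) * (c : ℕ) = k * (k + 1) := by
      have : ((n : ℕ) : ZMod 11) = (c : ℕ) := by rw [← hn, ZMod.natCast_mod]
      rw [← this]
      exact_mod_cast congrArg (Nat.cast : ℕ → ZMod 11) hk2
    have key : ∀ c ∈ ({2, 4, 5, 7, 8, 9} : Finset ℕ), ∀ x : ZMod 11,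
        2 * (c : ZMod 11) = x * (x + 1) → 2 * x + 1 = 0 := by
      decide
    rw [key c hc _ hk3, mul_zero]
  · exact h.2 fun k h => hk ⟨k, h⟩

theorem classPart_pentagonalSeries {c : ℕ} (hc : c ∈ ({3, 6, 8, 9, 10} : Finset ℕ)) :
    classPart 11 c (pentagonalSeries (ZMod 11)) = 0 := by
  refine classPart_eq_zero fun n hn => coeff_pentagonalSeries_eq_zero _ ?_
  rintro ⟨k, rfl⟩
  have hk := congrArg (Int.cast : ℤ → ZMod 11) (two_mul_natCast_pentagonal k)
  push_cast at hk
  rw [show ((pentagonal k : ℕ) : ZMod 11) = (c : ℕ) by rw [← hn, ZMod.natCast_mod]] at hk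
  have key : ∀ c ∈ ({3, 6, 8, 9, 10} : Finset ℕ), ∀ x : ZMod 11,
      2 * (c : ZMod 11) ≠ x * (3 * x - 1) := by
    decide
  exact key c hc _ hk

theorem coeff_pentagonalSeries_pow_ten {m : ℕ} (hm : m % 11 = 6) :
    coeff m (pentagonalSeries (ZMod 11) ^ 10) = 0 := by
  have : Fact (Nat.Prime 11) := ⟨by norm_num⟩
  refine coeff_eq_zero_of_classPart_eq_zero ?_ hm
  set E := pentagonalSeries (ZMod 11) with hE
  have h11 : (11 : (ZMod 11)⟦X⟧) = 0 := by
    rw [← map_ofNat (C (R := ZMod 11)) 11, show (OfNat.ofNat 11 : ZMod 11) = 0 from rfl, map_zero]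
  have h7 := classPart_six_pow_seven h11 (J := E ^ 3)
    (fun c hc => classPart_pentagonalSeries_pow_three hc) (fun c hc => by
      -- E^11 = E(q^11) does not mix residue classes, so E^12 inherits the gaps of E.
      rw [show (E ^ 3) ^ 4 = E * E ^ 11 by ring, ← expand_zmod 11 (by norm_num),
        classPart_mul_expand, classPart_pentagonalSeries hc, zero_mul])
  rw [show (E ^ 3) ^ 7 = E ^ 10 * E ^ 11 by ring, ← expand_zmod 11 (by norm_num),
    classPart_mul_expand, expand_zmod 11] at h7
  exact ((isUnit_pentagonalSeries (ZMod 11)).pow 11).mul_left_eq_zero.mp h7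

end EulerPowers

/-! ### Self-similarity of the theta series -/

section ThetaDissection

theorem coeff_thetaProduct_eq {R : Type*} [CommRing R] (h2 : IsUnit (2 : R)) {e : ℤ} {N M : ℕ}
    (h : ∑ v ∈ formSolutions (24 * N + 5), sign12 v.1 =
      e * ∑ v ∈ formSolutions (24 * M + 5), sign12 v.1) :
    coeff N (thetaProduct R) = e * coeff M (thetaProduct R) := by
  refine h2.mul_left_cancel ?_
  rw [two_mul_coeff_thetaProduct, h, Int.cast_mul, ← two_mul_coeff_thetaProduct]
  ring

/-- The number represented is 24(pn+3) + 5 = 24pn + 77. For p = 7, 11, p² divides it exactly when n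
≡ s mod p, and the quotient is then 24⌊n/p⌋ + 5. -/
theorem dissect_thetaProduct {R : Type*} [CommRing R] (h2 : IsUnit (2 : R)) {p s : ℕ} (hp : p ≠ 0)
    (hs : s < p) (e : ℤ)
    (h : ∀ n, n % p = s → ∑ v ∈ formSolutions (24 * (p * n + 3) + 5), sign12 v.1 =
      e * ∑ v ∈ formSolutions (24 * (n / p) + 5), sign12 v.1)
    (h0 : ∀ n, n % p ≠ s → ∑ v ∈ formSolutions (24 * (p * n + 3) + 5), sign12 v.1 = 0) :
    dissect p 3 (thetaProduct R) = C (e : R) * (X ^ s * expand p hp (thetaProduct R)) := by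
  ext n
  rw [coeff_dissect, coeff_C_mul, coeff_X_pow_mul']
  by_cases hn : n % p = s
  · have hn' := Nat.div_add_mod n p
    rw [if_pos (by omega), show n - s = p * (n / p) by omega, coeff_expand_mul]
    exact coeff_thetaProduct_eq h2 (h n hn)
  · have h3 : coeff (p * n + 3) (thetaProduct R) = 0 := by
      -- Vanishing is the case of multiplier 0, for which M is arbitrary.
      have := coeff_thetaProduct_eq h2 (M := 0) (e := 0) ((h0 n hn).trans (zero_mul _).symm)
      simpa using this
    rw [h3]
    split_ifs with hle
    · rw [coeff_expand_of_not_dvd, mul_zero]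
      rintro ⟨k, hk⟩
      refine hn ?_
      rw [show n = s + p * k by omega, Nat.add_mul_mod_self_left, Nat.mod_eq_of_lt hs]
    · rw [mul_zero]

theorem dissect_seven_thetaProduct :
    dissect 7 3 (thetaProduct (ZMod 7)) =
      C ((1 : ℤ) : ZMod 7) * (X ^ 1 * expand 7 (by norm_num) (thetaProduct (ZMod 7))) := by
  refine dissect_thetaProduct (IsUnit.of_mul_eq_one 4 rfl) _ (by norm_num) 1 ?_ ?_
  · intro n hn
    rw [sum_sign12_seven ⟨24 * n + 11, by ring⟩, if_pos (by omega), one_mul]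
    congr 2
    omega
  · intro n hn
    rw [sum_sign12_seven ⟨24 * n + 11, by ring⟩, if_neg (by omega)]

theorem dissect_eleven_thetaProduct :
    dissect 11 3 (thetaProduct (ZMod 11)) =
      C ((-1 : ℤ) : ZMod 11) * (X ^ 2 * expand 11 (by norm_num) (thetaProduct (ZMod 11))) := by
  refine dissect_thetaProduct (IsUnit.of_mul_eq_one 6 rfl) _ (by norm_num) (-1) ?_ ?_
  · intro n hn
    rw [sum_sign12_eleven ⟨24 * n + 7, by ring⟩, if_pos (by omega), neg_one_mul]
    congr 3
    omega
  · intro n hn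
    rw [sum_sign12_eleven ⟨24 * n + 7, by ring⟩, if_neg (by omega)]

end ThetaDissection

/-! ### The two congruences -/

section Congruences

theorem pentagonalSeries_mul_thetaProduct (R : Type*) [CommRing R] :
    pentagonalSeries R * thetaProduct R = expand 2 two_ne_zero (pentagonalSeries R) ^ 3 := by
  rw [thetaProduct, mul_left_comm, pentagonalSeries_mul_triangleSeries]
  ring

theorem cubicPartitionCount_modEq_zero {p d r s : ℕ} [Fact p.Prime] (hp : p ≠ 0) (hpd : p = d + 2)
    (hp3 : 3 < p) (hr : r < p) (c : ZMod p)
    (htheta : dissect p 3 (thetaProduct (ZMod p)) =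
      C c * (X ^ s * expand p hp (thetaProduct (ZMod p))))
    (hE : dissect p r (X ^ s * expand 2 two_ne_zero (pentagonalSeries (ZMod p) ^ (p - 1))) = 0)
    (n : ℕ) : cubicPartitionCount d (p * (p * n + r) + 3) ≡ 0 [MOD p] := by
  set E := pentagonalSeries (ZMod p) with hEdef
  set F := expand 2 two_ne_zero E with hF
  set G := cubicPartitionSeries (ZMod p) d with hG
  have hEu : IsUnit E := isUnit_pentagonalSeries _
  have hFu : IsUnit F := hEu.map _
  have hG1 : G * (E * F ^ (d - 1)) = 1 := cubicPartitionSeries_mul (ZMod p) (by omega)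
  have hEθ : E * thetaProduct (ZMod p) = F ^ 3 := pentagonalSeries_mul_thetaProduct _
  have hGθ : expand p hp F * G = thetaProduct (ZMod p) := by
    have hFp : F ^ p = F ^ (d - 1) * F ^ 3 := by
      rw [← pow_add]
      congr 1
      omega
    rw [expand_zmod, hFp, ← hEθ]
    linear_combination thetaProduct (ZMod p) * hG1
  have h1 : F * dissect p 3 G = C c * (X ^ s * thetaProduct (ZMod p) ^ p) := by
    rw [← dissect_expand_mul hp hp3, hGθ, htheta, expand_zmod p hp]
  have h2 : expand p hp E * dissect p 3 G =
      expand p hp (C c * F ^ 2) * (X ^ s * expand 2 two_ne_zero (E ^ (p - 1))) := by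
    refine hFu.mul_left_cancel ?_
    -- F^(3p) is split so that one F cancels, F^(2p) is a series in q^p, and F^(p-1) remains to be
    -- extracted.
    have h3 : (E * thetaProduct (ZMod p)) ^ p = F ^ (p - 1) * F * (F ^ 2) ^ p := by
      rw [hEθ, ← pow_succ, Nat.sub_add_cancel (by omega)]
      ring
    rw [mul_pow] at h3
    rw [map_mul, expand_C, expand_zmod p hp, expand_zmod p hp, map_pow, ← hF]
    linear_combination E ^ p * h1 + C c * X ^ s * h3
  have h4 : E * dissect p r (dissect p 3 G) = 0 := by
    rw [← dissect_expand_mul hp hr, h2, dissect_expand_mul hp hr, hE, mul_zero]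
  have h5 := congrArg (coeff n) (hEu.mul_right_eq_zero.mp h4)
  rw [coeff_dissect, coeff_dissect, hG, cubicPartitionSeries, coeff_mk, map_zero] at h5
  exact Nat.modEq_zero_iff_dvd.mpr ((ZMod.natCast_eq_zero_iff _ _).mp h5)

theorem dissect_X_pow_mul_expand_eq_zero {R : Type*} [CommRing R] {p r s : ℕ} {f : R⟦X⟧}
    (h : ∀ m n, p * n + r = s + 2 * m → coeff m f = 0) :
    dissect p r (X ^ s * expand 2 two_ne_zero f) = 0 := by
  ext n
  rw [coeff_dissect, coeff_X_pow_mul', map_zero]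
  split_ifs with hs
  · rw [coeff_expand]
    split_ifs with hd
    · exact h _ n (by omega)
    · rfl
  · rfl

end Congruences

theorem theorem6p1 :
    (∀ n : ℕ, cubicPartitionCount 5 (49 * n + 31) ≡ 0 [MOD 7]) ∧
    (∀ n : ℕ, cubicPartitionCount 9 (121 * n + 36) ≡ 0 [MOD 11]) := by
  constructor
  · intro n
    have : Fact (Nat.Prime 7) := ⟨by norm_num⟩
    have h := cubicPartitionCount_modEq_zero (p := 7) (d := 5) (r := 4) (by norm_num) rfl
      (by norm_num) (by norm_num) _ dissect_seven_thetaProduct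
      -- Here 7k + 4 = 1 + 2m forces m ≡ 5 mod 7.
      (dissect_X_pow_mul_expand_eq_zero fun m k hmk =>
        coeff_pentagonalSeries_pow_six (by omega)) n
    rwa [show 7 * (7 * n + 4) + 3 = 49 * n + 31 by ring] at h
  · intro n
    have : Fact (Nat.Prime 11) := ⟨by norm_num⟩
    have h := cubicPartitionCount_modEq_zero (p := 11) (d := 9) (r := 3) (by norm_num) rfl
      (by norm_num) (by norm_num) _ dissect_eleven_thetaProduct
      -- Here 11k + 3 = 2 + 2m forces m ≡ 6 mod 11.
      (dissect_X_pow_mul_expand_eq_zero fun m k hmk =>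
        coeff_pentagonalSeries_pow_ten (by omega)) n
    rwa [show 11 * (11 * n + 3) + 3 = 121 * n + 36 by ring] at h
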